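/- Let $\mathfrak g$ be a finite-dimensional simple complex Lie algebra with Cartan subalgebra $\mathfrak h$, root system $R\subset\mathfrak h^*$, simple roots $\{\alpha_i\}_{i\in I}$, simple coroots $h_i\in\mathfrak h$, root spaces $\mathfrak g_\alpha$, and $Q^+=\sum_{i}\mathbb Z_{\ge 0}\alpha_i$, $R^+=R\cap Q^+$, $\mathfrak n^+=\bigoplus_{\alpha\in R^+}\mathfrak g_\alpha$; let $x_i^-$ be a nonzero vector of $\mathfrak g_{-\alpha_i}$. Let $A$ be a commutative associative unital $\mathbb C$-algebra, let $\mathfrak g\otimes A$ be the Lie algebra with bracket $[x\otimes a,y\otimes b]=[x,y]\otimes ab$, and identify $\mathfrak g$ with $\mathfrak g\otimes 1$. For a $\mathfrak g\otimes A$-module $V$ and $\mu\in\mathfrak h^*$ put $V_\mu=\{v\in V: hv=\mu(h)v\ \ \forall h\in\mathfrak h\}$. Let $\lambda\in\mathfrak h^*$ be dominant integral, i.e. $\lambda(h_i)\in\mathbb Z_{\ge0}$ for all $i\in I$. Let $\mathcal I_A^\lambda$ be the full subcategory of the category of $\mathfrak g\otimes A$-modules consisting of those $V$ that are locally finite-dimensional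 as $\mathfrak g$-modules and satisfy $V_\mu\neq0\Rightarrow\lambda-\mu\in Q^+$; it is an abelian category. Let $W_A(\lambda)$ be the global Weyl module, i.e. the $\mathfrak g\otimes A$-module generated by an element $w_\lambda$ with defining relations $$(\mathfrak n^+\otimes A)w_\lambda=0,\qquad hw_\lambda=\lambda(h)w_\lambda\ (h\in\mathfrak h),\qquad (x_i^-)^{\lambda(h_i)+1}w_\lambda=0\ (i\in I).$$ It carries a right action of the commutative algebra $U(\mathfrak h\otimes A)$, given by $(uw_\lambda)v=(uv)w_\lambda$ for $u\in U(\mathfrak g\otimes A)$, $v\in U(\mathfrak h\otimes A)$. This action factors through $\mathbf A_\lambda=U(\mathfrak h\otimes A)/\{v: vw_\lambda=0\}$. Let $\operatorname{mod}\mathbf A_\lambda$ be the category of all left $\mathbf A_\lambda$-modules. Then $W_A(\lambda)\otimes_{\mathbf A_\lambda}M$ lies in $\mathcal I_A^\lambda$ for every $M\in\operatorname{mod}\mathbf A_\lambda$, and the resulting functor $$\mathbf W_A^\lambda:\operatorname{mod}\mathbf A_\lambda\to\mathcal I_A^\lambda,\qquad \mathbf W_A^\lambda M=W_A(\lambda)\otimes_{\mathbf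 A_\lambda}M,\quad \mathbf W_A^\lambda f=1\otimes f,$$ is exact if and only if $$\operatorname{Ext}^2_{\mathcal I_A^\lambda}(\mathbf W_A^\lambda M,U)=0$$ for every $M\in\operatorname{mod}\mathbf A_\lambda$ and every $U\in\mathcal I_A^\lambda$ with $U_\lambda=0$. -/

import Mathlib

open CategoryTheory TensorProduct

universe u

noncomputable section

namespace GlobalWeyl

section Enveloping

attribute [local instance 100] LieRing.ofAssociativeRing

theorem uea_adjoin {𝔞 : Type*} [LieRing 𝔞] [LieAlgebra ℂ 𝔞]
    (S : Subalgebra ℂ (UniversalEnvelopingAlgebra ℂ 𝔞))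
    (hS : ∀ x : 𝔞, UniversalEnvelopingAlgebra.ι ℂ x ∈ S)
    (u : UniversalEnvelopingAlgebra ℂ 𝔞) : u ∈ S := by
  let f : 𝔞 →ₗ⁅ℂ⁆ S :=
    { toFun := fun x => ⟨UniversalEnvelopingAlgebra.ι ℂ x, hS x⟩
      map_add' := fun x y => by ext; simp
      map_smul' := fun c x => by ext; simp
      map_lie' := fun {x y} => by
        ext
        simp [LieRing.of_associative_ring_bracket] }
  have h : S.val.comp (UniversalEnvelopingAlgebra.lift ℂ f) = AlgHom.id ℂ _ := by
    apply UniversalEnvelopingAlgebra.hom_ext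
    refine LieHom.ext fun x => ?_
    simp [f]
  have := congrArg (fun g => g u) h
  simp only [AlgHom.comp_apply, AlgHom.id_apply] at this
  rw [← this]
  exact Subtype.property _

theorem uea_mul_comm {𝔞 : Type*} [LieRing 𝔞] [LieAlgebra ℂ 𝔞] [IsLieAbelian 𝔞]
    (u v : UniversalEnvelopingAlgebra ℂ 𝔞) : u * v = v * u := by
  have h1 : ∀ (x y : 𝔞), UniversalEnvelopingAlgebra.ι ℂ x * UniversalEnvelopingAlgebra.ι ℂ y
      = UniversalEnvelopingAlgebra.ι ℂ y * UniversalEnvelopingAlgebra.ι ℂ x := by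
    intro x y
    have := (UniversalEnvelopingAlgebra.ι ℂ).map_lie x y
    rw [trivial_lie_zero, map_zero, LieRing.of_associative_ring_bracket] at this
    exact (sub_eq_zero.mp this.symm)
  have h2 : ∀ (x : 𝔞) (w : UniversalEnvelopingAlgebra ℂ 𝔞),
      w * UniversalEnvelopingAlgebra.ι ℂ x = UniversalEnvelopingAlgebra.ι ℂ x * w := by
    intro x w
    have := uea_adjoin (Subalgebra.centralizer ℂ {UniversalEnvelopingAlgebra.ι ℂ x})
      (fun y => by
        rw [Subalgebra.mem_centralizer_iff]
        rintro _ rfl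
        exact h1 x y) w
    rw [Subalgebra.mem_centralizer_iff] at this
    exact (this _ rfl).symm
  have := uea_adjoin (Subalgebra.centralizer ℂ {u})
      (fun y => by
        rw [Subalgebra.mem_centralizer_iff]
        rintro _ rfl
        exact h2 y _) v
  rw [Subalgebra.mem_centralizer_iff] at this
  exact this _ rfl

/-- The universal enveloping algebra of an abelian Lie algebra is commutative. -/
instance {𝔞 : Type*} [LieRing 𝔞] [LieAlgebra ℂ 𝔞] [IsLieAbelian 𝔞] :
    CommRing (UniversalEnvelopingAlgebra ℂ 𝔞) :=
  { (inferInstance : Ring (UniversalEnvelopingAlgebra ℂ 𝔞)) with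
    mul_comm := uea_mul_comm }

instance {A 𝔞 : Type*} [CommRing A] [Algebra ℂ A] [LieRing 𝔞] [LieAlgebra ℂ 𝔞]
    [IsLieAbelian 𝔞] : IsLieAbelian (A ⊗[ℂ] 𝔞) where
  trivial x y := by
    induction x using TensorProduct.induction_on with
    | zero => simp
    | add x₁ x₂ h₁ h₂ => simp [h₁, h₂]
    | tmul a x =>
      induction y using TensorProduct.induction_on with
      | zero => simp
      | add y₁ y₂ h₁ h₂ => simp [h₁, h₂]
      | tmul c y => simp [LieAlgebra.ExtendScalars.bracket_tmul, trivial_lie_zero]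

end Enveloping

section Identities

variable {R : Type*} [Ring R] [Algebra ℂ R]

theorem pow_comm_identity {y K F : R} {c : ℂ} (hK : K * y = y * K - c • F)
    (hF : F * y = y * F) (n : ℕ) :
    K * y ^ (n + 1) = y ^ (n + 1) * K - ((n + 1 : ℂ) * c) • (F * y ^ n) := by
  have hFn : ∀ n : ℕ, F * y ^ n = y ^ n * F := fun n =>
    (Commute.pow_right (show Commute F y from hF) n)
  induction n with
  | zero => simp [hK]
  | succ n ih =>
    rw [pow_succ y (n + 1), ← mul_assoc, ih, sub_mul, mul_assoc, hK, smul_mul_assoc,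
      mul_assoc F, ← pow_succ, mul_sub, mul_smul_comm, hFn (n + 1), mul_assoc]
    push_cast
    module

theorem raise_identity {y K F E : R} (hE : E * y = y * E + K) (hK : K * y = y * K - (2 : ℂ) • F)
    (hF : F * y = y * F) (n : ℕ) :
    y * (E * y ^ (n + 1)) = y ^ (n + 2) * E + (n + 1 : ℂ) • (y ^ (n + 1) * K)
      - ((n + 1 : ℂ) * n) • (F * y ^ n) := by
  have hFn : ∀ n : ℕ, F * y ^ n = y ^ n * F := fun n =>
    (Commute.pow_right (show Commute F y from hF) n)
  induction n with
  | zero => simp [hE, mul_add, pow_two, mul_assoc]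
  | succ n ih =>
    have : y * (E * y ^ (n + 1 + 1)) = (y * (E * y ^ (n + 1))) * y := by
      rw [pow_succ y (n + 1)]; simp only [mul_assoc]
    rw [this, ih]
    simp only [add_mul, sub_mul, smul_mul_assoc, mul_assoc, hE, hK, hF, mul_add,
      mul_sub, mul_smul_comm, hFn]
    simp only [← mul_assoc, ← pow_succ]
    push_cast
    module

/-- If the left ideal `J` contains `E` and `y ^ (n + 1)` then it contains `y ^ (n + 1) * T`. -/
theorem pow_mul_mem {J : Submodule R R} {y K F E T : R} {c : ℂ} (n : ℕ)
    (hE : E * y = y * E + K) (hK : K * y = y * K - (2 : ℂ) • F) (hF : F * y = y * F)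
    (hT : T * y = y * T - c • F) (hEJ : E ∈ J) (hyJ : y ^ (n + 1) ∈ J) :
    y ^ (n + 1) * T ∈ J := by
  have hsm : ∀ (z : ℂ) (r : R), r ∈ J → z • r ∈ J := fun z r hr => by
    rw [Algebra.smul_def]; exact J.smul_mem _ hr
  have hl : ∀ (s r : R), r ∈ J → s * r ∈ J := fun s r hr => J.smul_mem s hr
  have hFn : F * y ^ n ∈ J := by
    have h1 : y ^ (n + 1) * K - ((n + 1 : ℂ) * 2) • (F * y ^ n) ∈ J := by
      rw [← pow_comm_identity hK hF]; exact hl _ _ hyJ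
    have h2 : (n + 1 : ℂ) • (y ^ (n + 1) * K) - ((n + 1 : ℂ) * n) • (F * y ^ n) ∈ J := by
      have h3 := raise_identity hE hK hF n
      have : (n + 1 : ℂ) • (y ^ (n + 1) * K) - ((n + 1 : ℂ) * n) • (F * y ^ n)
          = y * (E * y ^ (n + 1)) - y ^ (n + 2) * E := by rw [h3]; module
      rw [this]
      exact J.sub_mem (hl _ _ (hl _ _ hyJ)) (hl _ _ hEJ)
    have h4 : ((n + 1 : ℂ) * (n + 2)) • (F * y ^ n) ∈ J := by
      have := J.sub_mem h2 (hsm (n + 1) _ h1)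
      convert this using 1
      module
    have h5 := hsm (((n + 1 : ℂ) * (n + 2))⁻¹) _ h4
    rwa [smul_smul, inv_mul_cancel₀, one_smul] at h5
    refine mul_ne_zero ?_ ?_
    · exact_mod_cast Nat.succ_ne_zero n
    · exact_mod_cast Nat.succ_ne_zero (n + 1)
  have h6 := pow_comm_identity hT hF n
  have : y ^ (n + 1) * T = T * y ^ (n + 1) + ((n + 1 : ℂ) * c) • (F * y ^ n) := by
    rw [h6]; module
  rw [this]
  exact J.add_mem (hl _ _ hyJ) (hsm _ _ hFn)

end Identities

section Setup

variable {L : Type u} [LieRing L] [LieAlgebra ℂ L] [FiniteDimensional ℂ L] [LieAlgebra.IsSimple ℂ L]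
  {H : LieSubalgebra ℂ L} [H.IsCartanSubalgebra]

/-- The submonoid `Q⁺` of `𝔥*` spanned by the simple roots. -/
def Qplus (b : (LieAlgebra.IsKilling.rootSystem H).Base) : AddSubmonoid (Module.Dual ℂ H) :=
  AddSubmonoid.closure ((LieAlgebra.IsKilling.rootSystem H).root '' b.support)

/-- `lam` is a dominant integral weight: `lam (h_i)` is a non-negative integer for every simple
coroot `h_i`. -/
def IsDominantIntegral (b : (LieAlgebra.IsKilling.rootSystem H).Base)
    (lam : Module.Dual ℂ H) : Prop :=
  ∀ i ∈ b.support, ∃ n : ℕ, lam ((LieAlgebra.IsKilling.rootSystem H).coroot i) = n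

variable (A : Type u) [CommRing A] [Algebra ℂ A]

/-- The enveloping algebra `U(𝔞 ⊗ A)`; the bracket of `𝔞 ⊗ A` is
`[x ⊗ a, y ⊗ a'] = [x, y] ⊗ a a'` (Mathlib writes the factor `A` on the left). -/
abbrev Env (𝔞 : Type u) [LieRing 𝔞] [LieAlgebra ℂ 𝔞] : Type u :=
  UniversalEnvelopingAlgebra ℂ (A ⊗[ℂ] 𝔞)

variable {A} in
/-- The element `x ⊗ a` of `U(𝔞 ⊗ A)`. -/
def cur {𝔞 : Type u} [LieRing 𝔞] [LieAlgebra ℂ 𝔞] (a : A) (x : 𝔞) : Env A 𝔞 :=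
  UniversalEnvelopingAlgebra.ι ℂ (a ⊗ₜ[ℂ] x)

attribute [local instance 100] LieRing.ofAssociativeRing in
variable {A} in
theorem cur_mul_cur {𝔞 : Type u} [LieRing 𝔞] [LieAlgebra ℂ 𝔞] (a c : A) (x y : 𝔞) :
    (cur a x * cur c y : Env A 𝔞) = cur c y * cur a x + cur (a * c) ⁅x, y⁆ := by
  have := (UniversalEnvelopingAlgebra.ι ℂ).map_lie (a ⊗ₜ[ℂ] x) (c ⊗ₜ[ℂ] y)
  rw [LieAlgebra.ExtendScalars.bracket_tmul, LieRing.of_associative_ring_bracket] at this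
  unfold cur
  rw [this]; abel

variable {A} in
theorem cur_smul {𝔞 : Type u} [LieRing 𝔞] [LieAlgebra ℂ 𝔞] (a : A) (z : ℂ) (x : 𝔞) :
    (cur a (z • x) : Env A 𝔞) = z • cur a x := by
  simp [cur]

attribute [local instance 100] LieRing.ofAssociativeRing in
variable (H) in
/-- The algebra map `U(𝔥 ⊗ A) → U(𝔤 ⊗ A)` induced by the inclusion of `𝔥` in `𝔤`. -/
def cartanIncl : Env A H →ₐ[ℂ] Env A L :=
  UniversalEnvelopingAlgebra.lift ℂ
    ((UniversalEnvelopingAlgebra.ι ℂ).comp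
      (LieAlgebra.ExtendScalars.map (AlgHom.id ℂ A) H.incl))

theorem cartanIncl_cur (a : A) (h : H) : cartanIncl H A (cur a h) = cur a (h : L) := by
  simp [cartanIncl, cur]

variable (b : (LieAlgebra.IsKilling.rootSystem H).Base) (lam : Module.Dual ℂ H)

/-- The relations of the global Weyl module: `(𝔫⁺ ⊗ A) w = 0`, `h w = lam (h) w` for `h ∈ 𝔥`, and
`(x_i⁻)^(lam (h_i) + 1) w = 0` for every simple root `α_i`, where `x_i⁻` runs through the
(one-dimensional) root space of `-α_i`. -/
inductive WeylRel : Env A L → Prop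
  | raising (α : H.root) (hα : (LieAlgebra.IsKilling.rootSystem H).root α ∈ Qplus b)
      (x : L) (hx : x ∈ LieAlgebra.rootSpace H (α : LieModule.Weight ℂ H L)) (a : A) :
      WeylRel (cur a x)
  | cartan (h : H) : WeylRel (cur 1 (h : L) - algebraMap ℂ (Env A L) (lam h))
  | lowering (i : H.root) (hi : i ∈ b.support) (x : L)
      (hx : x ∈ LieAlgebra.rootSpace H (-(i : LieModule.Weight ℂ H L))) (n : ℕ)
      (hn : lam ((LieAlgebra.IsKilling.rootSystem H).coroot i) = n) :
      WeylRel (cur 1 x ^ (n + 1))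

/-- The left ideal of `U(𝔤 ⊗ A)` generated by the relations of the global Weyl module. -/
def weylIdeal : Submodule (Env A L) (Env A L) :=
  Submodule.span (Env A L) {u | WeylRel A b lam u}

/-- The global Weyl module `W_A(lam)`, a left module over `U(𝔤 ⊗ A)`. -/
def WeylModule : Type u := Env A L ⧸ weylIdeal A b lam

instance : AddCommGroup (WeylModule A b lam) :=
  inferInstanceAs (AddCommGroup (Env A L ⧸ weylIdeal A b lam))

instance : Module (Env A L) (WeylModule A b lam) :=
  inferInstanceAs (Module (Env A L) (Env A L ⧸ weylIdeal A b lam))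

/-- The generator `w` of the global Weyl module. -/
def weylGen : WeylModule A b lam := Submodule.Quotient.mk (p := weylIdeal A b lam) 1

theorem mul_cartan_mem (a : A) (h : H) {r : Env A L} (hr : WeylRel A b lam r) :
    r * cur a (h : L) ∈ weylIdeal A b lam := by
  have hsub : ∀ {r : Env A L}, WeylRel A b lam r → r ∈ weylIdeal A b lam :=
    fun hr => Submodule.subset_span hr
  have hsm : ∀ (z : ℂ) (r : Env A L), r ∈ weylIdeal A b lam → z • r ∈ weylIdeal A b lam :=
    fun z r hr => by rw [Algebra.smul_def]; exact Submodule.smul_mem _ _ hr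
  have hl : ∀ (s r : Env A L), r ∈ weylIdeal A b lam → s * r ∈ weylIdeal A b lam :=
    fun s r hr => Submodule.smul_mem _ s hr
  have hroot : ∀ {χ : H → ℂ} {x : L}, x ∈ LieAlgebra.rootSpace H χ → ∀ k : H,
      ⁅(k : L), x⁆ = χ k • x := fun hx k => LieAlgebra.IsKilling.lie_eq_smul_of_mem_rootSpace hx k
  cases hr with
  | raising α hα x hx a' =>
    rw [cur_mul_cur, ← lie_skew, hroot hx h, ← neg_smul, cur_smul]
    exact Submodule.add_mem _ (hl _ _ (hsub (.raising α hα x hx a')))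
      (hsm _ _ (hsub (.raising α hα x hx _)))
  | cartan h' =>
    have hz : ⁅(h' : L), (h : L)⁆ = 0 := by
      rw [← LieSubalgebra.coe_bracket, trivial_lie_zero, ZeroMemClass.coe_zero]
    have : (cur 1 (h' : L) - algebraMap ℂ (Env A L) (lam h')) * cur a (h : L)
        = cur a (h : L) * (cur 1 (h' : L) - algebraMap ℂ (Env A L) (lam h')) := by
      rw [sub_mul, mul_sub, cur_mul_cur, hz, Algebra.commutes]
      simp [cur]
    rw [this]
    exact hl _ _ (hsub (.cartan h'))
  | lowering i hi x hx n hn =>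
    have hi0 : (i : LieModule.Weight ℂ H L).IsNonZero := by
      obtain ⟨i, hi2⟩ := i; simpa using hi2
    obtain ⟨k, e, f, ht, he, hf⟩ :=
      LieAlgebra.IsKilling.exists_isSl2Triple_of_weight_isNonZero hi0
    have hk := ht.h_eq_coroot hi0 he hf
    obtain ⟨c, hc⟩ : ∃ c : ℂ, c • f = x := by
      have h1 := LieAlgebra.IsKilling.finrank_rootSpace_eq_one
        (-(i : LieModule.Weight ℂ H L)) (by simpa using hi0)
      rw [LieModule.Weight.coe_neg] at h1
      obtain ⟨c, hc⟩ := (finrank_eq_one_iff_of_nonzero' (⟨f, hf⟩ :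
        LieAlgebra.rootSpace H (-(i : LieModule.Weight ℂ H L)))
        (by simpa using ht.f_ne_zero)).mp h1 ⟨x, hx⟩
      exact ⟨c, congrArg Subtype.val hc⟩
    by_cases hc0 : c = 0
    · have : (cur 1 x : Env A L) = 0 := by rw [← hc, hc0]; simp [cur]
      rw [this]
      simp
    have hex : ⁅c⁻¹ • e, x⁆ = k := by
      rw [← hc, smul_lie, lie_smul, smul_smul, inv_mul_cancel₀ hc0, one_smul, ht.lie_e_f]
    have hkx : ⁅k, x⁆ = -((2 : ℂ) • x) := by
      rw [← hc, lie_smul, ht.lie_h_f_nsmul]; module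
    refine pow_mul_mem (E := cur a (c⁻¹ • e)) (K := cur a k) (F := cur a x)
      (c := (i : LieModule.Weight ℂ H L) h) n ?_ ?_ ?_ ?_ ?_ (hsub (.lowering i hi x hx n hn))
    · rw [cur_mul_cur, hex, mul_one]
    · rw [cur_mul_cur, hkx, mul_one, ← neg_smul, cur_smul]; module
    · rw [cur_mul_cur, lie_self]; simp [cur]
    · rw [cur_mul_cur, hroot hx h, mul_one, cur_smul, Pi.neg_apply]; module
    · exact hsub (.raising i (AddSubmonoid.subset_closure ⟨i, hi, rfl⟩) _
        (Submodule.smul_mem _ _ he) a)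

/-- The left ideal of relations is stable under right multiplication by `U(𝔥 ⊗ A)`. -/
theorem weylIdeal_mul_cartanIncl (v : Env A H) :
    ∀ r ∈ weylIdeal A b lam, r * cartanIncl H A v ∈ weylIdeal A b lam := by
  let S : Subalgebra ℂ (Env A H) :=
    { carrier := {v | ∀ r ∈ weylIdeal A b lam, r * cartanIncl H A v ∈ weylIdeal A b lam}
      mul_mem' := fun {v w} hv hw r hr => by
        rw [map_mul, ← mul_assoc]; exact hw _ (hv _ hr)
      add_mem' := fun {v w} hv hw r hr => by
        rw [map_add, mul_add]; exact Submodule.add_mem _ (hv _ hr) (hw _ hr)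
      algebraMap_mem' := fun z r hr => by
        rw [AlgHom.commutes, ← Algebra.commutes]; exact Submodule.smul_mem _ _ hr }
  refine uea_adjoin S (fun y => ?_) v
  induction y using TensorProduct.induction_on with
  | zero => rw [map_zero]; exact S.zero_mem
  | add x₁ x₂ h₁ h₂ => rw [map_add]; exact S.add_mem h₁ h₂
  | tmul a h =>
    intro r hr
    change r * cartanIncl H A (cur a h) ∈ _
    rw [cartanIncl_cur]
    refine Submodule.span_induction (p := fun r _ => r * cur a (h : L) ∈ weylIdeal A b lam)
      (fun r hr => mul_cartan_mem A b lam a h hr) ?_ ?_ ?_ hr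
    · simp
    · intro x y _ _ hx hy
      rw [add_mul]; exact Submodule.add_mem _ hx hy
    · intro c x _ hx
      rw [smul_eq_mul, mul_assoc]; exact Submodule.smul_mem _ _ hx

/-- The right action of `U(𝔥 ⊗ A)` on `W_A(lam)`: `(u w) · v = (u v) w`. It is an action of a
commutative ring, hence a ring homomorphism to the endomorphisms. -/
def rightAct : Env A H →+* Module.End (Env A L) (WeylModule A b lam) where
  toFun v := Submodule.mapQ (weylIdeal A b lam) (weylIdeal A b lam)
    (LinearMap.toSpanSingleton (Env A L) (Env A L) (cartanIncl H A v))
    (fun r hr => weylIdeal_mul_cartanIncl A b lam v r hr)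
  map_one' := by
    refine LinearMap.ext fun w => ?_
    obtain ⟨u, rfl⟩ := Submodule.Quotient.mk_surjective (weylIdeal A b lam) w
    simp
    rfl
  map_zero' := by
    refine LinearMap.ext fun w => ?_
    obtain ⟨u, rfl⟩ := Submodule.Quotient.mk_surjective (weylIdeal A b lam) w
    simp
    rfl
  map_add' x y := by
    refine LinearMap.ext fun w => ?_
    obtain ⟨u, rfl⟩ := Submodule.Quotient.mk_surjective (weylIdeal A b lam) w
    simp [mul_add]
    rfl
  map_mul' x y := by
    refine LinearMap.ext fun w => ?_
    obtain ⟨u, rfl⟩ := Submodule.Quotient.mk_surjective (weylIdeal A b lam) w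
    rw [mul_comm x y]
    change Submodule.Quotient.mk (p := weylIdeal A b lam) (u * cartanIncl H A (y * x)) =
      Submodule.Quotient.mk (p := weylIdeal A b lam) (u * cartanIncl H A y * cartanIncl H A x)
    rw [map_mul, mul_assoc]

theorem exists_smul_weylGen (w : WeylModule A b lam) :
    ∃ u : Env A L, w = u • weylGen A b lam := by
  obtain ⟨u, rfl⟩ := Submodule.Quotient.mk_surjective (weylIdeal A b lam) w
  refine ⟨u, ?_⟩
  change _ = Submodule.Quotient.mk (p := weylIdeal A b lam) (u • 1)
  rw [smul_eq_mul, mul_one]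

theorem rightAct_smul_weylGen (v : Env A H) (u : Env A L) :
    rightAct A b lam v (u • weylGen A b lam) = (u * cartanIncl H A v) • weylGen A b lam := by
  rw [map_smul, mul_smul]
  congr 1
  change Submodule.Quotient.mk (p := weylIdeal A b lam) ((1 : Env A L) • cartanIncl H A v) =
    Submodule.Quotient.mk (p := weylIdeal A b lam) (cartanIncl H A v • 1)
  rw [smul_eq_mul, smul_eq_mul, mul_one, one_mul]

/-- The ideal of all `v ∈ U(𝔥 ⊗ A)` with `v w = 0`. -/
def annIdeal : Ideal (Env A H) where
  carrier := {v | cartanIncl H A v • weylGen A b lam = 0}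
  add_mem' {x y} hx hy := by
    simp only [Set.mem_ofPred_eq] at hx hy ⊢
    rw [map_add, add_smul, hx, hy, add_zero]
  zero_mem' := by simp
  smul_mem' c x hx := by
    simp only [Set.mem_ofPred_eq] at hx ⊢
    rw [smul_eq_mul, map_mul, mul_smul, hx, smul_zero]

/-- The algebra `𝐀_lam`, the quotient of `U(𝔥 ⊗ A)` by the annihilator of `w`. -/
def WeylAlg : Type u := Env A H ⧸ annIdeal A b lam

instance : CommRing (WeylAlg A b lam) :=
  inferInstanceAs (CommRing (Env A H ⧸ annIdeal A b lam))

/-- The right action of `𝐀_lam` on `W_A(lam)`. -/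
def rightActWeylAlg : WeylAlg A b lam →+* Module.End (Env A L) (WeylModule A b lam) :=
  Ideal.Quotient.lift (annIdeal A b lam) (rightAct A b lam) (fun v hv => by
    refine LinearMap.ext fun w => ?_
    obtain ⟨u, rfl⟩ := exists_smul_weylGen A b lam w
    rw [rightAct_smul_weylGen, mul_smul, show cartanIncl H A v • weylGen A b lam = 0 from hv,
      smul_zero, LinearMap.zero_apply])

/-- `W_A(lam)` as a module over the commutative ring `𝐀_lam`, through the right action. -/
instance : Module (WeylAlg A b lam) (WeylModule A b lam) :=
  Module.compHom _ (rightActWeylAlg A b lam)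

instance : SMulCommClass (WeylAlg A b lam) (Env A L) (WeylModule A b lam) where
  smul_comm s u w := map_smul (rightActWeylAlg A b lam s) u w

instance : SMulCommClass (Env A L) (WeylAlg A b lam) (WeylModule A b lam) :=
  SMulCommClass.symm _ _ _

/-- The functor `M ↦ W_A(lam) ⊗ M` over `𝐀_lam`, `f ↦ 1 ⊗ f`, from `𝐀_lam`-modules to
`𝔤 ⊗ A`-modules. -/
def weylFunctor : ModuleCat.{u} (WeylAlg A b lam) ⥤ ModuleCat.{u} (Env A L) where
  obj M := ModuleCat.of (Env A L) (WeylModule A b lam ⊗[WeylAlg A b lam] M)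
  map {M N} f := ModuleCat.ofHom
    { LinearMap.lTensor (WeylModule A b lam) f.hom with
      map_smul' := fun u x => by
        induction x using TensorProduct.induction_on with
        | zero => simp
        | tmul w m => simp [TensorProduct.smul_tmul']
        | add x y hx hy => 
          simp only [smul_add, map_add, AddHom.toFun_eq_coe, LinearMap.coe_toAddHom] at hx hy ⊢
          rw [hx, hy] }
  map_id M := by
    ext x
    simp
  map_comp f g := by
    ext x
    simp [LinearMap.lTensor_comp]

instance : (weylFunctor A b lam).Additive where
  map_add {M N f g} := by
    ext x
    simp [weylFunctor, LinearMap.lTensor_add]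
    rfl
open scoped ModuleCat

variable {A} in
/-- The weight space `V_mu = {v | h v = mu (h) v for all h ∈ 𝔥}` of a `𝔤 ⊗ A`-module `V`. -/
def weightSpace (V : ModuleCat.{u} (Env A L)) (mu : Module.Dual ℂ H) : Submodule ℂ V where
  carrier := {v | ∀ h : H, (cur 1 (h : L) : Env A L) • v = mu h • v}
  add_mem' {v w} hv hw h := by rw [smul_add, smul_add, hv h, hw h]
  zero_mem' h := by simp
  smul_mem' z v hv h := by
    rw [smul_comm, hv h, smul_comm]

variable {A} in
/-- `V` is locally finite-dimensional as a `𝔤`-module: every vector lies in a finite-dimensional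
`𝔤`-stable subspace. -/
def IsLocallyFinite (V : ModuleCat.{u} (Env A L)) : Prop :=
  ∀ v : V, ∃ F : Submodule ℂ V, v ∈ F ∧ FiniteDimensional ℂ F ∧
    ∀ x : L, ∀ w ∈ F, (cur 1 x : Env A L) • w ∈ F

/-- The objects of `I_A^lam`: the `𝔤 ⊗ A`-modules which are locally finite-dimensional over `𝔤` and
all of whose weights lie in `lam - Q⁺`. -/
def weylProp : ObjectProperty (ModuleCat.{u} (Env A L)) := fun V =>
  IsLocallyFinite V ∧ ∀ mu : Module.Dual ℂ H, weightSpace V mu ≠ ⊥ → lam - mu ∈ Qplus b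

/-- A weight of a quotient of a finite-dimensional `𝔥`-module is a weight of the module. -/
theorem exists_weight_lift {V V' : Type*} [AddCommGroup V] [Module ℂ V] [FiniteDimensional ℂ V]
    [LieRingModule H V] [LieModule ℂ H V] [AddCommGroup V'] [Module ℂ V']
    [LieRingModule H V'] [LieModule ℂ H V']
    (f : V →ₗ⁅ℂ,H⁆ V') (hf : Function.Surjective f) (mu : Module.Dual ℂ H) (v' : V')
    (hv' : v' ≠ 0) (h' : ∀ h : H, ⁅h, v'⁆ = mu h • v') :
    ∃ v : V, v ≠ 0 ∧ ∀ h : H, ⁅h, v⁆ = mu h • v := by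
  by_cases hbot : LieModule.genWeightSpace V (mu : H → ℂ) = ⊥
  · exfalso
    have hfin : FiniteDimensional ℂ V' := Module.Finite.of_surjective (f : V →ₗ[ℂ] V') hf
    have htop : (⨆ χ : H → ℂ, LieModule.genWeightSpace V χ) = ⊤ :=
      LieModule.iSup_genWeightSpace_eq_top ℂ H V
    have hle : (⊤ : LieSubmodule ℂ H V') ≤
        ⨆ χ : H → ℂ, ⨆ _ : χ ≠ mu, LieModule.genWeightSpace V' χ := by
      rw [← (LieModuleHom.range_eq_top f).mpr hf, ← LieModuleHom.map_top, ← htop,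
        LieSubmodule.map_iSup]
      refine iSup_le fun χ => ?_
      by_cases hχ : χ = mu
      · rw [hχ, hbot, LieSubmodule.map_bot]; exact bot_le
      · exact (LieModule.map_genWeightSpace_le f).trans
          (le_iSup₂_of_le (f := fun (χ : H → ℂ) (_ : χ ≠ mu) => LieModule.genWeightSpace V' χ)
            χ hχ le_rfl)
    have hind := LieModule.iSupIndep_genWeightSpace ℂ H V' (mu : H → ℂ)
    have hmem : v' ∈ LieModule.genWeightSpace V' (mu : H → ℂ) :=
      LieModule.weightSpace_le_genWeightSpace V' _ ((LieModule.mem_weightSpace _ _).mpr h')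
    have := (hind.mono_right hle).le_bot ⟨hmem, trivial⟩
    exact hv' (by simpa using this)
  · obtain ⟨v, hv, h⟩ := LieModule.exists_forall_lie_eq_smul ℂ H V ⟨mu, hbot⟩
    exact ⟨v, hv, h⟩

/-- A `𝔥`-stable subspace of a `𝔤 ⊗ A`-module, as an `𝔥`-module. -/
abbrev stableLieRingModule (V : ModuleCat.{u} (Env A L)) (F : Submodule ℂ V)
    (hF : ∀ x : L, ∀ w ∈ F, (cur 1 x : Env A L) • w ∈ F) : LieRingModule H F where
  bracket h w := ⟨(cur 1 (h : L) : Env A L) • (w : V), hF _ _ w.2⟩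
  add_lie x y w := by
    ext
    simp [cur, TensorProduct.tmul_add, add_smul]
  lie_add x v w := by
    ext
    simp
  leibniz_lie x y w := by
    ext
    have := cur_mul_cur (1 : A) (1 : A) (x : L) (y : L)
    change (cur 1 (x : L) : Env A L) • (cur 1 (y : L) : Env A L) • (w : V) =
      (cur 1 ((⁅x, y⁆ : H) : L) : Env A L) • (w : V) +
        (cur 1 (y : L) : Env A L) • (cur 1 (x : L) : Env A L) • (w : V)
    rw [← mul_smul, this, add_smul, mul_smul, mul_one, LieSubalgebra.coe_bracket, add_comm]

theorem stableLieModule (V : ModuleCat.{u} (Env A L)) (F : Submodule ℂ V)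
    (hF : ∀ x : L, ∀ w ∈ F, (cur 1 x : Env A L) • w ∈ F) :
    letI : LieRingModule H F := stableLieRingModule A V F hF
    LieModule ℂ H F :=
  letI : LieRingModule H F := stableLieRingModule A V F hF
  { smul_lie := fun z x w => by
      ext
      change (cur 1 ((z • x : H) : L) : Env A L) • (w : V) =
        z • (cur 1 (x : L) : Env A L) • (w : V)
      rw [SetLike.val_smul, cur_smul, smul_assoc]
    lie_smul := fun z x w => by
      ext
      change (cur 1 (x : L) : Env A L) • (z • (w : V)) = z • (cur 1 (x : L) : Env A L) • (w : V)
      rw [smul_comm] }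

theorem weylProp_of_jointly_injective {J : Type} [Finite J] {X : ModuleCat.{u} (Env A L)}
    (Y : J → ModuleCat.{u} (Env A L)) (f : ∀ j, X ⟶ Y j)
    (hf : ∀ x : X, (∀ j, (f j).hom x = 0) → x = 0) (hY : ∀ j, weylProp A b lam (Y j)) :
    weylProp A b lam X := by
  have := Fintype.ofFinite J
  refine ⟨fun v => ?_, fun mu hmu => ?_⟩
  · choose F hv hfd hst using fun j => (hY j).1 ((f j).hom v)
    let g : ∀ j, X →ₗ[ℂ] Y j := fun j => (f j).hom.restrictScalars ℂ
    refine ⟨⨅ j, (F j).comap (g j), ?_, ?_, ?_⟩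
    · simp only [Submodule.mem_iInf, Submodule.mem_comap]
      exact hv
    · let G : (⨅ j, (F j).comap (g j) : Submodule ℂ X) →ₗ[ℂ] (∀ j, F j) :=
        LinearMap.pi fun j => ((g j).comp (Submodule.subtype _)).codRestrict (F j)
          (fun x => (Submodule.mem_iInf _).mp x.2 j)
      have hG : Function.Injective G := by
        rw [← LinearMap.ker_eq_bot, LinearMap.ker_eq_bot']
        intro x hx
        ext
        exact hf _ fun j => congrArg Subtype.val (congrFun hx j)
      exact FiniteDimensional.of_injective G hG
    · intro x w hw
      simp only [Submodule.mem_iInf, Submodule.mem_comap] at hw ⊢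
      intro j
      change (f j).hom ((cur 1 x : Env A L) • w) ∈ F j
      rw [map_smul]
      exact hst j x _ (hw j)
  · obtain ⟨v, hv, hv0⟩ := (Submodule.ne_bot_iff _).mp hmu
    obtain ⟨j, hj⟩ : ∃ j, (f j).hom v ≠ 0 := by
      by_contra hcon
      push Not at hcon
      exact hv0 (hf v hcon)
    refine (hY j).2 mu ((Submodule.ne_bot_iff _).mpr ⟨(f j).hom v, fun h => ?_, hj⟩)
    rw [← map_smul, hv h]
    exact ((f j).hom.restrictScalars ℂ).map_smul (mu h) v

instance : (weylProp A b lam).IsClosedUnderSubobjects where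
  prop_of_mono {X Y} f _ hY := by
    have hf : Function.Injective f.hom := (ModuleCat.mono_iff_injective f).mp inferInstance
    exact weylProp_of_jointly_injective A b lam (J := Unit) (fun _ => Y) (fun _ => f)
      (fun x hx => hf (by rw [hx (), map_zero])) (fun _ => hY)

instance : (weylProp A b lam).IsClosedUnderQuotients where
  prop_of_epi {X Y} f _ hX := by
    have hf : Function.Surjective f.hom := (ModuleCat.epi_iff_surjective f).mp inferInstance
    let g : X →ₗ[ℂ] Y := f.hom.restrictScalars ℂ
    have hst' : ∀ F : Submodule ℂ X, (∀ x : L, ∀ w ∈ F, (cur 1 x : Env A L) • w ∈ F) →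
        ∀ x : L, ∀ w ∈ F.map g, (cur 1 x : Env A L) • w ∈ F.map g := by
      rintro F hst x _ ⟨w, hw, rfl⟩
      exact ⟨_, hst x w hw, map_smul f.hom _ _⟩
    refine ⟨fun y => ?_, fun mu hmu => ?_⟩
    · obtain ⟨x, rfl⟩ := hf y
      obtain ⟨F, hx, hfd, hst⟩ := hX.1 x
      exact ⟨F.map g, ⟨x, hx, rfl⟩, inferInstance, hst' F hst⟩
    · obtain ⟨y, hy, hy0⟩ := (Submodule.ne_bot_iff _).mp hmu
      obtain ⟨x, rfl⟩ := hf y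
      obtain ⟨F, hx, hfd, hst⟩ := hX.1 x
      let i1 : LieRingModule H F := stableLieRingModule A X F hst
      have : LieModule ℂ H F := stableLieModule A X F hst
      let i2 : LieRingModule H (F.map g) := stableLieRingModule A Y (F.map g) (hst' F hst)
      have : LieModule ℂ H (F.map g) := stableLieModule A Y (F.map g) (hst' F hst)
      let p : F →ₗ⁅ℂ,H⁆ F.map g :=
        { g.submoduleMap F with
          map_lie' := fun {h w} => Subtype.ext (map_smul f.hom (cur 1 (h : L) : Env A L) (w : X)) }
      obtain ⟨v, hv0, hv⟩ := exists_weight_lift p (g.submoduleMap_surjective F) mu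
        ⟨g x, x, hx, rfl⟩ (fun h0 => hy0 (congrArg Subtype.val h0)) (fun h => Subtype.ext (hy h))
      refine hX.2 mu ((Submodule.ne_bot_iff _).mpr ⟨v, fun h => ?_, fun h0 => hv0 (Subtype.ext h0)⟩)
      exact congrArg Subtype.val (hv h)

instance : (weylProp A b lam).ContainsZero where
  exists_zero := ⟨ModuleCat.of (Env A L) PUnit, ModuleCat.isZero_of_subsingleton _,
    weylProp_of_jointly_injective A b lam (J := Empty) (fun j => j.elim) (fun j => j.elim)
      (fun x _ => Subsingleton.elim (α := PUnit) x 0) (fun j => j.elim)⟩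

instance : (weylProp A b lam).IsClosedUnderFiniteProducts where
  isClosedUnderLimitsOfShape J _ :=
    { limitsOfShape_le := by
        rintro X ⟨p⟩
        refine weylProp_of_jointly_injective A b lam (J := J) (fun j => p.diag.obj ⟨j⟩)
          (fun j => p.π.app ⟨j⟩) (fun x hx => ?_) (fun j => p.prop_diag_obj _)
        refine Limits.Concrete.isLimit_ext _ p.isLimit x 0 ?_
        rintro ⟨j⟩
        exact (hx j).trans (map_zero (p.π.app ⟨j⟩).hom).symm }

/-- The category `I_A^lam`, a full subcategory of the category of `𝔤 ⊗ A`-modules. -/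
abbrev WeylCat : Type (u + 1) := (weylProp A b lam).FullSubcategory

instance : HasExt.{u + 1} (WeylCat A b lam) := HasExt.standard _

end Setup

end GlobalWeyl

end

open GlobalWeyl

/-!
The proof separates a homological statement from the representation theory which feeds it.

Homological part (`exact_iff_subsingleton_ext_two`). Write `W` for the Weyl functor and call `U`
small if `U_lam = 0`. For a free presentation `0 → N → P → M → 0`, right exactness of `W` makes `W N` map
onto the kernel `I` of `W P → W M`. Since `Hom (W N, U) = 0` for `U` small and `W P` is projective,
`Ext¹ (W M, U) = 0`, with no exactness hypothesis on `W`. If `W` is exact then `I = W N`, and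
dimension shifting gives `Ext² (W M, U) = Ext¹ (W N, U) = 0`. Conversely, let
`0 → M₁ → M₂ → M₃ → 0` be exact and let `K` be the kernel of `W M₁ → W M₂`; it is small. If `I` is
the kernel of `W M₂ → W M₃`, then `Ext¹ (I, K)` lies between `Ext¹ (W M₂, K) = 0` and
`Ext² (W M₃, K) = 0`. Hence `0 → K → W M₁ → I → 0` splits, and `Hom (W M₁, K) = 0` forces `K = 0`.

The representation theory provides the following.

* `W_A(lam)` is locally finite over `𝔤` (`isLocallyFinite_of_generator`). The vectors on which a
  given `x ∈ 𝔤` acts locally finitely form a `𝔤 ⊗ A`-submodule, since `𝔤` acts locally finitely on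
  `𝔤 ⊗ A`; so it suffices to look at the generator `w`. The simple root vectors, positive and
  negative, act locally finitely on `w`, hence the set of weights is stable under simple
  reflections (`weightSpace_reflection_ne_bot`). The weights are `≤ lam`, so no string of weights is
  infinite in the direction of a simple root, and by reflecting, in the direction of any root. Thus
  all root vectors are nilpotent on `w`, and ordered monomials in a basis of `𝔤` produce
  finite-dimensional `𝔤`-stable subspaces (`exists_finiteDimensional_stable`).
* `W_A(lam)` is the sum of `𝐀_lam w` and of weight spaces of weights `< lam`, by the triangular
  decomposition (`mem_cartanSpan_sup_iSup_weightSpace`). Therefore `w` spans a free direct summand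
  of the `𝐀_lam`-module `W_A(lam)` (`exists_weylProj`), and the space of weight `lam` of
  `W_A(lam) ⊗ M` is a copy `w ⊗ M` of `M`. This is why the kernel `K` above is small.
* In an object of `I_A^lam` every vector of weight `lam` satisfies the relations of `w`
  (`smul_eq_zero_of_mem_weylIdeal`), and `V ↦ V_lam` preserves surjections
  (`exists_mem_weightSpace_map_eq`). For the latter, vectors lift to the generalized weight space of
  `lam`, on which the simple raising operators vanish and the Cartan subalgebra therefore acts
  semisimply (`lie_eq_smul_of_mem_maxGenEigenspace`). So `W` maps free modules to projective
  objects.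
-/

set_option linter.unusedSectionVars false

namespace GlobalWeyl

/-! ### Exactness of a right exact functor and vanishing of `Ext²` -/

section Homological

open Limits Abelian

universe w v₁ v₂ u₁ u₂

variable {D : Type u₁} [Category.{v₁} D] [Abelian D] {C : Type u₂} [Category.{v₂} C] [Abelian C]

/-- The kernel of an epimorphism gives a short exact sequence. -/
theorem shortExact_kernel_of_epi {X Y : C} (g : X ⟶ Y) [Epi g] :
    (ShortComplex.mk (kernel.ι g) g (kernel.condition g)).ShortExact where
  exact := ShortComplex.exact_kernel g

variable [HasExt.{w} C]

/-- If every morphism from the middle term of `0 → X₁ → X₂ → X₃ → 0` to `X₁` vanishes and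
`Ext¹ (X₃, X₁) = 0`, then the identity of `X₁` extends to `X₂` and hence `X₁ = 0`. -/
theorem isZero_of_subsingleton_ext_one {S : ShortComplex C} (hS : S.ShortExact)
    (h1 : Subsingleton (Ext.{w} S.X₃ S.X₁ 1)) (h0 : ∀ r : S.X₂ ⟶ S.X₁, r = 0) :
    IsZero S.X₁ := by
  obtain ⟨x, hx⟩ := Ext.contravariant_sequence_exact₁ hS S.X₁ (Ext.mk₀ (𝟙 S.X₁)) (add_zero 1)
    (Subsingleton.elim _ _)
  obtain ⟨r, rfl⟩ := (Ext.mk₀_bijective _ _).2 x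
  rw [h0 r, Ext.mk₀_zero, Ext.comp_zero] at hx
  rw [IsZero.iff_id_eq_zero]
  exact (Ext.mk₀_eq_zero_iff _).mp hx.symm

/-- Dimension shifting: if `Extⁿ⁺¹ (X₂, U) = 0` and `Extⁿ (X₁, U) = 0` then
`Extⁿ⁺¹ (X₃, U) = 0`. -/
theorem subsingleton_ext_of_shortExact {S : ShortComplex C} (hS : S.ShortExact) (U : C) (n m : ℕ)
    (hnm : 1 + n = m) (h2 : Subsingleton (Ext.{w} S.X₂ U m))
    (h1 : Subsingleton (Ext.{w} S.X₁ U n)) : Subsingleton (Ext.{w} S.X₃ U m) := by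
  refine subsingleton_of_forall_eq 0 fun x => ?_
  obtain ⟨y, rfl⟩ := Ext.contravariant_sequence_exact₃ hS U x (Subsingleton.elim _ _) hnm
  rw [Subsingleton.elim y 0, Ext.comp_zero]

/-- If `Extⁿ (X₂, U) = 0` and `Extⁿ⁺¹ (X₃, U) = 0` then `Extⁿ (X₁, U) = 0`. -/
theorem subsingleton_ext_left_of_shortExact {S : ShortComplex C} (hS : S.ShortExact) (U : C)
    (n m : ℕ) (hnm : 1 + n = m) (h2 : Subsingleton (Ext.{w} S.X₂ U n))
    (h3 : Subsingleton (Ext.{w} S.X₃ U m)) : Subsingleton (Ext.{w} S.X₁ U n) := by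
  refine subsingleton_of_forall_eq 0 fun x => ?_
  obtain ⟨y, rfl⟩ := Ext.contravariant_sequence_exact₁ hS U x hnm (Subsingleton.elim _ _)
  rw [Subsingleton.elim y 0, Ext.comp_zero]

/-- Let `F` be a right exact functor such that every object is a quotient of an object with
projective image, and let `𝒰` be a class of objects which receive no nonzero morphism from the image
of `F` and which contains the subobjects killed by `F f`, for `f` a monomorphism. Then `F` is exact
if and only if `Ext² (F M, U) = 0` for all `M` and all `U ∈ 𝒰`. -/
theorem exact_iff_subsingleton_ext_two (F : D ⥤ C) [F.Additive]
    (hproj : ∀ M : D, ∃ (P : D) (p : P ⟶ M), Epi p ∧ Projective (F.obj P))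
    (hright : ∀ S : ShortComplex D, S.ShortExact → (S.map F).Exact ∧ Epi (F.map S.g))
    (𝒰 : ObjectProperty C)
    (hzero : ∀ (M : D) (U : C), 𝒰 U → ∀ f : F.obj M ⟶ U, f = 0)
    (hker : ∀ {M N : D} (f : M ⟶ N) [Mono f] (K : C) (k : K ⟶ F.obj M) [Mono k],
      k ≫ F.map f = 0 → 𝒰 K) :
    (∀ S : ShortComplex D, S.ShortExact → (S.map F).ShortExact) ↔
      ∀ (M : D) (U : C), 𝒰 U → Subsingleton (Ext.{w} (F.obj M) U 2) := by
  -- `Ext¹ (F M, U) = 0` holds without any exactness assumption on `F`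
  have hone : ∀ (M : D) (U : C), 𝒰 U → Subsingleton (Ext.{w} (F.obj M) U 1) := by
    intro M U hU
    obtain ⟨P, p, hp, hP⟩ := hproj M
    obtain ⟨hex, hepi⟩ := hright _ (shortExact_kernel_of_epi p)
    have : Epi (F.map p) := hepi
    refine subsingleton_ext_of_shortExact (shortExact_kernel_of_epi (F.map p)) U 0 1 rfl
      (Ext.subsingleton_of_projective (F.obj P) U 0) ?_
    refine subsingleton_of_forall_eq 0 fun x => ?_
    obtain ⟨r, rfl⟩ := (Ext.mk₀_bijective _ _).2 x
    have : Epi (kernel.lift (F.map p) (F.map (kernel.ι p)) (by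
        rw [← F.map_comp, kernel.condition, F.map_zero])) := hex.epi_kernelLift
    rw [Ext.mk₀_eq_zero_iff, ← cancel_epi (kernel.lift (F.map p) (F.map (kernel.ι p)) _),
      Limits.comp_zero]
    exact hzero _ U hU _
  constructor
  · intro hF M U hU
    obtain ⟨P, p, hp, hP⟩ := hproj M
    have hS := hF _ (shortExact_kernel_of_epi p)
    exact subsingleton_ext_of_shortExact hS U 1 2 rfl
      (Ext.subsingleton_of_projective (F.obj P) U 1) (hone _ U hU)
  · intro hext S hS
    obtain ⟨hex, hepi⟩ := hright S hS
    have : Epi (F.map S.g) := hepi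
    have hmono := hS.mono_f
    -- with `K` the kernel of `F f` and `I` the kernel of `F g`, the sequence `0 → K → F X₁ → I → 0`
    -- is exact, and `Ext¹ (I, K) = 0` by shifting along `0 → I → F X₂ → F X₃ → 0`
    have hKU : 𝒰 (kernel (F.map S.f)) := hker S.f _ (kernel.ι _) (kernel.condition _)
    have hI : (ShortComplex.mk (kernel.ι (F.map S.g)) (F.map S.g)
      (kernel.condition _)).ShortExact := shortExact_kernel_of_epi _
    have hN := subsingleton_ext_left_of_shortExact hI _ 1 2 rfl (hone S.X₂ _ hKU)
      (hext S.X₃ _ hKU)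
    let q := kernel.lift (F.map S.g) (F.map S.f) (S.map F).zero
    have hq : Epi q := hex.epi_kernelLift
    have hqi : q ≫ kernel.ι _ = F.map S.f := kernel.lift_ι _ _ _
    have hJ : (ShortComplex.mk (kernel.ι (F.map S.f)) q (by
      rw [← cancel_mono (kernel.ι (F.map S.g)), Category.assoc, hqi, kernel.condition,
        Limits.zero_comp])).ShortExact :=
      { exact := by
          refine ShortComplex.exact_of_f_is_kernel _ (KernelFork.IsLimit.ofι' _ _ fun k hk =>
            ⟨kernel.lift _ k (by rw [← hqi, ← Category.assoc, hk, Limits.zero_comp]),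
              kernel.lift_ι _ _ _⟩) }
    have hz := isZero_of_subsingleton_ext_one hJ hN (fun r => hzero _ _ hKU r)
    have : Mono (F.map S.f) := Preadditive.mono_of_kernel_zero (hz.eq_of_src _ _)
    exact { exact := hex, mono_f := this, epi_g := hepi }

end Homological

/-! ### Local finiteness from a spanning set of locally finite elements -/

section LocallyFinite

open LieModule

variable {K : Type*} [Field K] {𝔞 : Type*} [LieRing 𝔞] [LieAlgebra K 𝔞]
  {V : Type*} [AddCommGroup V] [Module K V]

/-- The smallest subspace containing `F` and stable under the endomorphism `T`. -/
def hull (T : Module.End K V) (F : Submodule K V) : Submodule K V :=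
  ⨆ k : ℕ, F.map (T ^ k)

theorem le_hull (T : Module.End K V) (F : Submodule K V) : F ≤ hull T F :=
  le_iSup_of_le 0 (by simp [Module.End.one_eq_id])

theorem apply_mem_hull {T : Module.End K V} {F : Submodule K V} {v : V} (hv : v ∈ hull T F) :
    T v ∈ hull T F := by
  refine (?_ : hull T F ≤ (hull T F).comap T) hv
  refine iSup_le fun k => ?_
  rintro _ ⟨w, hw, rfl⟩
  refine Submodule.mem_iSup_of_mem (k + 1) ⟨w, hw, ?_⟩
  rw [pow_succ', Module.End.mul_apply]

theorem hull_le {T : Module.End K V} {F G : Submodule K V} (hF : F ≤ G)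
    (hG : ∀ w ∈ G, T w ∈ G) : hull T F ≤ G := by
  refine iSup_le fun k => ?_
  rintro _ ⟨w, hw, rfl⟩
  induction k with
  | zero => exact hF hw
  | succ k ih => rw [pow_succ', Module.End.mul_apply]; exact hG _ ih

/-- `T` acts locally finitely on `V`: every vector lies in a finite-dimensional `T`-stable
subspace. -/
def IsLocFin (T : Module.End K V) : Prop :=
  ∀ v : V, ∃ F : Submodule K V, v ∈ F ∧ FiniteDimensional K F ∧ ∀ w ∈ F, T w ∈ F

theorem IsLocFin.finiteDimensional_hull {T : Module.End K V} (hT : IsLocFin T) {F : Submodule K V}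
    (hF : FiniteDimensional K F) : FiniteDimensional K (hull T F) := by
  obtain ⟨s, rfl⟩ : F.FG := Module.Finite.iff_fg.mp hF
  choose G hG hfd hst using hT
  have : FiniteDimensional K (⨆ v : s, G v : Submodule K V) := inferInstance
  refine Submodule.finiteDimensional_of_le (S₂ := ⨆ v : s, G v) (hull_le ?_ fun w hw => ?_)
  · exact Submodule.span_le.mpr fun v hv => Submodule.mem_iSup_of_mem ⟨v, hv⟩ (hG v)
  · refine (iSup_le fun v => ?_ : (⨆ v : s, G v) ≤ (⨆ v : s, G v).comap T) hw
    exact fun x hx => Submodule.mem_iSup_of_mem v (hst v x hx)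

variable [LieRingModule 𝔞 V] [LieModule K 𝔞 V]

/-- The vector `x_{i₁} (x_{i₂} (⋯ v))` attached to a word `[i₁, i₂, …]`. -/
def word {n : ℕ} (x : Fin n → 𝔞) (v : V) : List (Fin n) → V
  | [] => v
  | i :: l => ⁅x i, word x v l⁆

/-- Permuting the letters of a word changes the vector by a combination of shorter words. -/
theorem word_sub_word_mem_span {n : ℕ} (x : Fin n → 𝔞) (hx : Submodule.span K (Set.range x) = ⊤)
    (v : V) {l l' : List (Fin n)} (h : l.Perm l') :
    word x v l - word x v l' ∈
      Submodule.span K {w | ∃ m, m.length < l.length ∧ w = word x v m} := by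
  induction h with
  | nil => simp
  | @cons i l l' _ ih =>
    rw [word, word, ← lie_sub]
    refine (Submodule.span_le (p := (Submodule.span K _).comap (toEnd K 𝔞 V (x i)))).mpr ?_ ih
    rintro _ ⟨m, hm, rfl⟩
    exact Submodule.subset_span ⟨i :: m, by simpa using hm, rfl⟩
  | swap i j l =>
    rw [word, word, word, word, leibniz_lie (x j), add_sub_cancel_right]
    have hmem : ⁅x j, x i⁆ ∈ Submodule.span K (Set.range x) := hx ▸ trivial
    refine (Submodule.span_le (p := (Submodule.span K _).comap
      ((toEnd K 𝔞 V : 𝔞 →ₗ[K] Module.End K V).flip (word x v l)))).mpr ?_ hmem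
    rintro _ ⟨k, rfl⟩
    exact Submodule.subset_span ⟨k :: l, by simp, rfl⟩
  | @trans l₁ l₂ l₃ h₁ _ ih₁ ih₂ =>
    rw [← sub_add_sub_cancel _ (word x v l₂)]
    refine Submodule.add_mem _ ih₁ ?_
    rwa [h₁.length_eq]

/-- The easy half of the Poincaré–Birkhoff–Witt theorem: ordered words span all words. -/
theorem word_mem_span_sorted {n : ℕ} (x : Fin n → 𝔞) (hx : Submodule.span K (Set.range x) = ⊤)
    (v : V) (l : List (Fin n)) :
    word x v l ∈
      Submodule.span K {w | ∃ m : List (Fin n), m.Pairwise (· ≥ ·) ∧ w = word x v m} := by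
  induction hd : l.length using Nat.strong_induction_on generalizing l with
  | _ d ih =>
    have h := word_sub_word_mem_span (K := K) x hx v (List.perm_insertionSort (· ≥ ·) l).symm
    have h2 := (Submodule.span_le (p := Submodule.span K
      {w | ∃ m : List (Fin n), m.Pairwise (· ≥ ·) ∧ w = word x v m})).mpr (by
        rintro _ ⟨m, hm, rfl⟩
        exact ih _ (hd ▸ hm) m rfl) h
    have h3 := Submodule.add_mem _ h2 (Submodule.subset_span
      ⟨_, List.pairwise_insertionSort (· ≥ ·) l, rfl⟩)
    rwa [sub_add_cancel] at h3

/-- If a Lie algebra is spanned by finitely many elements acting locally finitely on a module, then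
the module is locally finite: the ordered words in these elements span a finite-dimensional
subspace. -/
theorem exists_finiteDimensional_stable {n : ℕ} (x : Fin n → 𝔞)
    (hx : Submodule.span K (Set.range x) = ⊤) (hloc : ∀ i, IsLocFin (toEnd K 𝔞 V (x i))) (v : V) :
    ∃ F : Submodule K V, v ∈ F ∧ FiniteDimensional K F ∧ ∀ y : 𝔞, ∀ w ∈ F, ⁅y, w⁆ ∈ F := by
  -- `g m` is spanned by the vectors `x_{m-1}^{k_{m-1}} ⋯ x_0^{k_0} v`
  obtain ⟨g, hg0, hg⟩ : ∃ g : ℕ → Submodule K V, g 0 = K ∙ v ∧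
      ∀ m, g (m + 1) = if h : m < n then hull (toEnd K 𝔞 V (x ⟨m, h⟩)) (g m) else g m :=
    ⟨fun m => Nat.rec (K ∙ v)
      (fun m F => if h : m < n then hull (toEnd K 𝔞 V (x ⟨m, h⟩)) F else F) m, rfl, fun m => rfl⟩
  have hmono : Monotone g := monotone_nat_of_le_succ fun m => by
    rw [hg]
    split_ifs
    · exact le_hull _ _
    · exact le_rfl
  have hfd : ∀ m, (g m).FG := fun m => by
    induction m with
    | zero => rw [hg0]; exact Submodule.fg_span_singleton v
    | succ m ih =>
      rw [hg]
      split_ifs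
      · exact Module.Finite.iff_fg.mp
          ((hloc _).finiteDimensional_hull (Module.Finite.iff_fg.mpr ih))
      · exact ih
  have hsorted : ∀ (l : List (Fin n)) (m : ℕ), l.Pairwise (· ≥ ·) → (∀ i ∈ l, (i : ℕ) < m) →
      word x v l ∈ g m := by
    intro l
    induction l with
    | nil =>
      exact fun m _ _ => hmono (Nat.zero_le m) (hg0 ▸ Submodule.mem_span_singleton_self v)
    | cons a l ih =>
      intro m hl hm
      rw [List.pairwise_cons] at hl
      have h1 := ih (a + 1) hl.2 fun i hi => Nat.lt_succ_of_le (hl.1 i hi)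
      refine hmono (Nat.succ_le_of_lt (hm a List.mem_cons_self)) ?_
      rw [hg, dif_pos a.2] at h1
      change word x v (a :: l) ∈ g (a + 1)
      rw [hg, dif_pos a.2]
      exact apply_mem_hull h1
  refine ⟨Submodule.span K (Set.range (word x v)), Submodule.subset_span ⟨[], rfl⟩, ?_, ?_⟩
  · have : Module.Finite K (g n) := Module.Finite.iff_fg.mpr (hfd n)
    refine Submodule.finiteDimensional_of_le (S₂ := g n) (Submodule.span_le.mpr ?_)
    rintro _ ⟨l, rfl⟩
    refine (Submodule.span_le.mpr ?_) (word_mem_span_sorted (K := K) x hx v l)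
    rintro _ ⟨m, hm, rfl⟩
    exact hsorted m n hm fun i _ => i.2
  · intro y w hw
    refine (Submodule.span_le (p := (Submodule.span K _).comap (toEnd K 𝔞 V y))).mpr ?_ hw
    rintro _ ⟨l, rfl⟩
    have hmem : y ∈ Submodule.span K (Set.range x) := hx ▸ trivial
    refine (Submodule.span_le (p := (Submodule.span K _).comap
      ((toEnd K 𝔞 V : 𝔞 →ₗ[K] Module.End K V).flip (word x v l)))).mpr ?_ hmem
    rintro _ ⟨k, rfl⟩
    exact Submodule.subset_span ⟨k :: l, rfl⟩

end LocallyFinite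

/-! ### Representations of `sl₂` -/

section SlTwo

open LieModule

variable {𝔞 : Type*} [LieRing 𝔞] [LieAlgebra ℂ 𝔞] {V : Type*} [AddCommGroup V] [Module ℂ V]
  [LieRingModule 𝔞 V] [LieModule ℂ 𝔞 V] {h e f : 𝔞}

/-- If `e` is nilpotent on an `h`-eigenvector `v` and `f` is nilpotent on every vector `e ^ p v`,
then some `e ^ p v` is a primitive vector of weight `n ∈ ℕ`, and its first `n` lowerings do not
vanish. -/
theorem exists_raise_lower_ne_zero (t : IsSl2Triple h e f) {v : V} (hv : v ≠ 0) {m : ℂ}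
    (hm : ⁅h, v⁆ = m • v) (he : ∃ k, (toEnd ℂ 𝔞 V e ^ k) v = 0)
    (hf : ∀ p, ∃ k, (toEnd ℂ 𝔞 V f ^ k) ((toEnd ℂ 𝔞 V e ^ p) v) = 0) :
    ∃ p n : ℕ, m + 2 * p = n ∧
      ∀ j ≤ n, (toEnd ℂ 𝔞 V f ^ j) ((toEnd ℂ 𝔞 V e ^ p) v) ≠ 0 := by
  obtain ⟨p, hp, hp'⟩ := Nat.exists_not_and_succ_of_not_zero_of_exists
    (p := fun k => (toEnd ℂ 𝔞 V e ^ k) v = 0) (by simpa using hv) he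
  have P : t.HasPrimitiveVectorWith ((toEnd ℂ 𝔞 V e ^ p) v) (m + 2 * p) :=
    { ne_zero := hp
      lie_h := t.lie_h_pow_toEnd_e hm p
      lie_e := by rwa [IsSl2Triple.lie_e_pow_toEnd_e] }
  obtain ⟨n, hn, hn'⟩ := Nat.exists_not_and_succ_of_not_zero_of_exists
    (p := fun k => (toEnd ℂ 𝔞 V f ^ k) ((toEnd ℂ 𝔞 V e ^ p) v) = 0) (by simpa using hp) (hf p)
  have hmn : m + 2 * p = n := by
    have := P.lie_e_pow_succ_toEnd_f n
    rw [hn', lie_zero, eq_comm, smul_eq_zero_iff_left hn, mul_eq_zero, sub_eq_zero] at this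
    exact this.resolve_left <| Nat.cast_add_one_ne_zero n
  exact ⟨p, n, hmn, fun j hj => P.pow_toEnd_f_ne_zero_of_eq_nat hmn hj⟩

/-- The formula `e fⁿ⁺¹ v = (n + 1) fⁿ (h - n) v` for a vector `v` killed by `e`, which need not be
an eigenvector of `h`. -/
theorem lie_pow_succ_of_lie_eq_zero (t : IsSl2Triple h e f) {v : V} (hv : ⁅e, v⁆ = 0) (n : ℕ) :
    ⁅e, (toEnd ℂ 𝔞 V f ^ (n + 1)) v⁆ =
      (n + 1 : ℂ) • (toEnd ℂ 𝔞 V f ^ n) (⁅h, v⁆ - (n : ℂ) • v) := by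
  have hh : ∀ n : ℕ, ⁅h, (toEnd ℂ 𝔞 V f ^ n) v⁆ =
      (toEnd ℂ 𝔞 V f ^ n) ⁅h, v⁆ - (2 * n : ℂ) • (toEnd ℂ 𝔞 V f ^ n) v := fun n => by
    induction n with
    | zero => simp
    | succ n ih =>
      rw [pow_succ', Module.End.mul_apply, Module.End.mul_apply, toEnd_apply_apply,
        toEnd_apply_apply, leibniz_lie h, ih, t.lie_lie_smul_f ℂ, lie_sub, lie_smul, neg_lie,
        smul_lie]
      push_cast
      module
  induction n with
  | zero => simp [leibniz_lie e, hv, t.lie_e_f]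
  | succ n ih =>
    rw [pow_succ', Module.End.mul_apply, toEnd_apply_apply, leibniz_lie e, t.lie_e_f, ih, hh,
      lie_smul, ← toEnd_apply_apply ℂ 𝔞 V f ((toEnd ℂ 𝔞 V f ^ n) _), ← Module.End.mul_apply,
      ← pow_succ']
    simp only [map_sub, map_smul]
    push_cast
    module

/-- A vector killed by `e` and by a power of `f` in a generalized eigenspace of `h` is an
eigenvector of `h`, since `eⁿ fⁿ v` is a multiple of `h (h - 1) ⋯ (h - n + 1) v`, where the
polynomial is squarefree. -/
theorem lie_eq_smul_of_mem_maxGenEigenspace (t : IsSl2Triple h e f) {n : ℕ} {c : ℂ} :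
    ∀ {v : V}, ⁅e, v⁆ = 0 → (toEnd ℂ 𝔞 V f ^ n) v = 0 →
      v ∈ (toEnd ℂ 𝔞 V h).maxGenEigenspace c → v ≠ 0 → ⁅h, v⁆ = c • v ∧ ∃ k < n, c = (k : ℂ) := by
  have hdis : ∀ {u : V} {d : ℂ}, u ∈ (toEnd ℂ 𝔞 V h).maxGenEigenspace c → ⁅h, u⁆ = d • u →
      d ≠ c → u = 0 := fun {u d} hu hd hdc => by
    refine Submodule.disjoint_def.mp ((toEnd ℂ 𝔞 V h).disjoint_genEigenspace hdc 1 ⊤) u ?_ hu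
    exact Module.End.mem_eigenspace_iff.mpr hd
  have hst : ∀ {u : V} (d : ℂ), u ∈ (toEnd ℂ 𝔞 V h).maxGenEigenspace c →
      ⁅h, u⁆ - d • u ∈ (toEnd ℂ 𝔞 V h).maxGenEigenspace c := fun {u} d hu =>
    Submodule.sub_mem _ (Module.End.mapsTo_maxGenEigenspace_of_comm (Commute.refl _) c hu)
      (Submodule.smul_mem _ _ hu)
  induction n with
  | zero => exact fun _ h0 _ hv => absurd (by simpa using h0) hv
  | succ n ih =>
    intro v hv hf hc hv0
    have h1 := lie_pow_succ_of_lie_eq_zero t hv n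
    rw [hf, lie_zero, eq_comm, smul_eq_zero_iff_right (Nat.cast_add_one_ne_zero n)] at h1
    by_cases h2 : ⁅h, v⁆ - (n : ℂ) • v = 0
    · have h3 := sub_eq_zero.mp h2
      have : (n : ℂ) = c := by
        by_contra hne
        exact hv0 (hdis hc h3 hne)
      exact ⟨this ▸ h3, n, Nat.lt_succ_self n, this.symm⟩
    · have he : ⁅e, ⁅h, v⁆ - (n : ℂ) • v⁆ = 0 := by
        rw [lie_sub, lie_smul, hv, leibniz_lie e, hv, ← lie_skew, t.lie_h_e_smul ℂ]
        simp [hv]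
      obtain ⟨h3, k, hk, rfl⟩ := ih he h1 (hst _ hc) h2
      refine ⟨?_, k, hk.trans (Nat.lt_succ_self n), rfl⟩
      rw [← sub_eq_zero]
      refine hdis (d := n) (hst _ hc) ?_ (by exact_mod_cast hk.ne')
      rw [lie_sub, lie_smul, smul_sub, ← sub_eq_zero] at h3 ⊢
      rw [← h3]
      module

end SlTwo

/-! ### Local finiteness and weights of `𝔤 ⊗ A`-modules -/

section WeightSpaces

open LieModule
open scoped ModuleCat

variable {L : Type u} [LieRing L] [LieAlgebra ℂ L] [FiniteDimensional ℂ L] [LieAlgebra.IsSimple ℂ L]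
  {H : LieSubalgebra ℂ L} [H.IsCartanSubalgebra] {A : Type u} [CommRing A] [Algebra ℂ A]
  {V : ModuleCat.{u} (Env A L)}

variable (V) in
/-- A `𝔤 ⊗ A`-module, as a `𝔤`-module. -/
@[reducible] def curLieRingModule : LieRingModule L V where
  bracket x v := (cur 1 x : Env A L) • v
  add_lie x y v := by simp [cur, TensorProduct.tmul_add, add_smul]
  lie_add x v w := smul_add _ _ _
  leibniz_lie x y v := by
    change (cur 1 x : Env A L) • (cur 1 y : Env A L) • v =
      (cur 1 ⁅x, y⁆ : Env A L) • v + (cur 1 y : Env A L) • (cur 1 x : Env A L) • v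
    rw [← mul_smul, cur_mul_cur, add_smul, mul_smul, mul_one, add_comm]

attribute [local instance] curLieRingModule

variable (V) in
theorem curLieModule : LieModule ℂ L V where
  smul_lie z x v := by
    change (cur 1 (z • x) : Env A L) • v = z • (cur 1 x : Env A L) • v
    rw [cur_smul, smul_assoc]
  lie_smul z x v := by
    change (cur 1 x : Env A L) • z • v = z • (cur 1 x : Env A L) • v
    rw [smul_comm]

attribute [local instance] curLieModule

theorem cur_one_smul (x : L) (v : V) : (cur 1 x : Env A L) • v = ⁅x, v⁆ := rfl

theorem lie_cur_smul (a : A) (x y : L) (v : V) :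
    ⁅y, (cur a x : Env A L) • v⁆ = (cur a x : Env A L) • ⁅y, v⁆ + (cur a ⁅y, x⁆ : Env A L) • v := by
  rw [← cur_one_smul, ← cur_one_smul, ← mul_smul, cur_mul_cur, add_smul, mul_smul, one_mul]

theorem cur_add {𝔞 : Type u} [LieRing 𝔞] [LieAlgebra ℂ 𝔞] (a : A) (x y : 𝔞) :
    (cur a (x + y) : Env A 𝔞) = cur a x + cur a y := by
  simp [cur, TensorProduct.tmul_add]

theorem cur_zero {𝔞 : Type u} [LieRing 𝔞] [LieAlgebra ℂ 𝔞] (a : A) : (cur a 0 : Env A 𝔞) = 0 := by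
  simp [cur]

/-- `U(𝔞 ⊗ A)` is generated by the elements `a ⊗ x`. -/
theorem env_mem_of_cur_mem {𝔞 : Type u} [LieRing 𝔞] [LieAlgebra ℂ 𝔞]
    (S : Subalgebra ℂ (Env A 𝔞)) (hS : ∀ (a : A) (x : 𝔞), cur a x ∈ S) (u : Env A 𝔞) : u ∈ S := by
  refine uea_adjoin S (fun y => ?_) u
  induction y using TensorProduct.induction_on with
  | zero => rw [map_zero]; exact S.zero_mem
  | add x₁ x₂ h₁ h₂ => rw [map_add]; exact S.add_mem h₁ h₂
  | tmul a h => exact hS a h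

theorem env_smul_mem (P : Submodule ℂ V)
    (hP : ∀ (a : A) (x : L), ∀ v ∈ P, (cur a x : Env A L) • v ∈ P) (u : Env A L) :
    ∀ v ∈ P, u • v ∈ P :=
  env_mem_of_cur_mem
    { carrier := {u | ∀ v ∈ P, u • v ∈ P}
      mul_mem' := fun {a b} ha hb v hv => by rw [mul_smul]; exact ha _ (hb _ hv)
      add_mem' := fun {a b} ha hb v hv => by rw [add_smul]; exact P.add_mem (ha _ hv) (hb _ hv)
      algebraMap_mem' := fun z v hv => by rw [algebraMap_smul]; exact P.smul_mem _ hv } hP u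

theorem cartanIncl_smul_mem (P : Submodule ℂ V)
    (hP : ∀ (a : A) (h : H), ∀ v ∈ P, (cur a (h : L) : Env A L) • v ∈ P) (u : Env A H) :
    ∀ v ∈ P, cartanIncl H A u • v ∈ P :=
  env_mem_of_cur_mem
    { carrier := {u | ∀ v ∈ P, cartanIncl H A u • v ∈ P}
      mul_mem' := fun {a b} ha hb v hv => by rw [map_mul, mul_smul]; exact ha _ (hb _ hv)
      add_mem' := fun {a b} ha hb v hv => by
        rw [map_add, add_smul]; exact P.add_mem (ha _ hv) (hb _ hv)
      algebraMap_mem' := fun z v hv => by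
        rw [AlgHom.commutes, algebraMap_smul]; exact P.smul_mem _ hv }
    (fun a h v hv => by rw [cartanIncl_cur]; exact hP a h v hv) u

variable (V) in
/-- The vectors of `V` which lie in a finite-dimensional subspace stable under `S ⊆ 𝔤`. -/
def locFinPart (S : Set L) : Submodule ℂ V where
  carrier := {v | ∃ F : Submodule ℂ V, v ∈ F ∧ FiniteDimensional ℂ F ∧
    ∀ x ∈ S, ∀ w ∈ F, (cur 1 x : Env A L) • w ∈ F}
  zero_mem' := ⟨⊥, rfl, inferInstance, fun x _ w hw => by
    rw [Submodule.mem_bot] at hw; simp [hw]⟩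
  add_mem' := by
    rintro v w ⟨F, hv, hF, hFS⟩ ⟨G, hw, hG, hGS⟩
    refine ⟨F ⊔ G, Submodule.add_mem_sup hv hw, inferInstance, fun x hx y hy => ?_⟩
    obtain ⟨p, hp, q, hq, rfl⟩ := Submodule.mem_sup.mp hy
    rw [smul_add]
    exact Submodule.add_mem_sup (hFS x hx p hp) (hGS x hx q hq)
  smul_mem' := fun z v ⟨F, hv, hF, hFS⟩ => ⟨F, F.smul_mem z hv, hF, hFS⟩

/-- The locally finite part is stable under `𝔤 ⊗ A`, because `𝔤` acts locally finitely on `𝔤 ⊗ A`: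
if `F` is `S`-stable, so is `F + (𝔤 ⊗ a) F`. -/
theorem cur_smul_mem_locFinPart (S : Set L) (a : A) (x : L) :
    ∀ v ∈ locFinPart V S, (cur a x : Env A L) • v ∈ locFinPart V S := by
  rintro v ⟨F, hv, hF, hFS⟩
  let B : L →ₗ[ℂ] V →ₗ[ℂ] V := LinearMap.mk₂ ℂ (fun x v => (cur a x : Env A L) • v)
    (fun x y v => by rw [cur_add, add_smul]) (fun z x v => by rw [cur_smul, smul_assoc])
    (fun x v w => smul_add _ _ _) (fun z x v => smul_comm _ _ _)
  have hB : ∀ x v, B x v = (cur a x : Env A L) • v := fun _ _ => rfl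
  have hfd : FiniteDimensional ℂ (Submodule.map₂ B ⊤ F) :=
    Module.Finite.iff_fg.mpr (Submodule.FG.map₂ _ Module.Finite.fg_top (Module.Finite.iff_fg.mp hF))
  refine ⟨F ⊔ Submodule.map₂ B ⊤ F, Submodule.mem_sup_right (Submodule.apply_mem_map₂ B
    (m := x) trivial hv), inferInstance, fun y hy w hw => ?_⟩
  refine (sup_le (fun w hw => Submodule.mem_sup_left (hFS y hy w hw)) ?_ :
    F ⊔ Submodule.map₂ B ⊤ F ≤ (F ⊔ Submodule.map₂ B ⊤ F).comap (toEnd ℂ L V y)) hw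
  refine Submodule.map₂_le.mpr fun x _ f hf => Submodule.mem_sup_right ?_
  change ⁅y, (cur a x : Env A L) • f⁆ ∈ _
  rw [lie_cur_smul]
  exact Submodule.add_mem _ (Submodule.apply_mem_map₂ B (m := x) trivial (hFS y hy f hf))
    (Submodule.apply_mem_map₂ B (m := ⁅y, x⁆) trivial hf)

theorem isLocallyFinite_iff_locFinPart_eq_top : IsLocallyFinite V ↔ locFinPart V Set.univ = ⊤ := by
  rw [Submodule.eq_top_iff']
  refine forall_congr' fun v => exists_congr fun F => ?_
  simp

/-- A vector killed by a power of `x` lies in the locally finite part of `x`. -/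
theorem mem_locFinPart_of_pow_eq_zero {x : L} {v : V} {n : ℕ} (h : (toEnd ℂ L V x ^ n) v = 0) :
    v ∈ locFinPart V {x} := by
  induction n generalizing v with
  | zero => rw [show v = 0 by simpa using h]; exact Submodule.zero_mem _
  | succ n ih =>
    obtain ⟨F, hF, hfd, hst⟩ := ih (v := ⁅x, v⁆) (by simpa [pow_succ] using h)
    refine ⟨F ⊔ ℂ ∙ v, Submodule.mem_sup_right (Submodule.mem_span_singleton_self v),
      inferInstance, ?_⟩
    rintro _ rfl w hw
    obtain ⟨p, hp, q, hq, rfl⟩ := Submodule.mem_sup.mp hw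
    obtain ⟨z, rfl⟩ := Submodule.mem_span_singleton.mp hq
    rw [smul_add, smul_comm]
    exact Submodule.mem_sup_left (F.add_mem (hst _ rfl p hp) (F.smul_mem z hF))

theorem cur_smul_mem_weightSpace {chi mu : Module.Dual ℂ H} {x : L}
    (hx : x ∈ LieAlgebra.rootSpace H (chi : H → ℂ)) (a : A) {v : V}
    (hv : v ∈ GlobalWeyl.weightSpace V mu) :
    (cur a x : Env A L) • v ∈ GlobalWeyl.weightSpace V (mu + chi) := fun h => by
  have h1 := lie_cur_smul a x (h : L) v
  have h2 : ⁅(h : L), x⁆ = chi h • x := LieAlgebra.IsKilling.lie_eq_smul_of_mem_rootSpace hx h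
  rw [h2, ← cur_one_smul, ← cur_one_smul,
    hv h, cur_smul, smul_comm _ (mu h), smul_assoc, ← add_smul] at h1
  exact h1

theorem cur_cartan_smul_mem_weightSpace {mu : Module.Dual ℂ H} (h : H) (a : A) {v : V}
    (hv : v ∈ GlobalWeyl.weightSpace V mu) :
    (cur a (h : L) : Env A L) • v ∈ GlobalWeyl.weightSpace V mu := by
  have := cur_smul_mem_weightSpace (chi := 0) (x := (h : L)) (by
    have := LieAlgebra.rootSpace_zero_eq ℂ L H
    change (h : L) ∈ LieAlgebra.rootSpace H (0 : H → ℂ)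
    rw [this]; exact h.2) a hv
  rwa [add_zero] at this

theorem pow_mem_weightSpace {chi mu : Module.Dual ℂ H} {x : L}
    (hx : x ∈ LieAlgebra.rootSpace H (chi : H → ℂ)) {v : V}
    (hv : v ∈ GlobalWeyl.weightSpace V mu) (k : ℕ) :
    (toEnd ℂ L V x ^ k) v ∈ GlobalWeyl.weightSpace V (mu + k • chi) := by
  induction k with
  | zero => simpa using hv
  | succ k ih =>
    rw [pow_succ', Module.End.mul_apply, succ_nsmul, ← add_assoc]
    exact cur_smul_mem_weightSpace hx 1 ih

variable (V H) in
theorem iSupIndep_weightSpace :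
    iSupIndep fun mu : Module.Dual ℂ H => GlobalWeyl.weightSpace V mu := by
  have h1 := LieModule.iSupIndep_genWeightSpace ℂ H V
  rw [← LieSubmodule.iSupIndep_toSubmodule] at h1
  refine (h1.comp (f := fun mu : Module.Dual ℂ H => (mu : H → ℂ)) DFunLike.coe_injective).mono
    fun mu v hv => ?_
  exact LieModule.weightSpace_le_genWeightSpace V _ ((LieModule.mem_weightSpace _ _).mpr hv)

theorem eq_zero_of_mem_weightSpace_of_mem_iSup {mu : Module.Dual ℂ H}
    {T : Module.Dual ℂ H → Prop} (hT : ¬ T mu) {v : V} (hv : v ∈ GlobalWeyl.weightSpace V mu)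
    (hv' : v ∈ ⨆ nu, ⨆ _ : T nu, GlobalWeyl.weightSpace V nu) : v = 0 := by
  have h := iSupIndep_weightSpace H V mu
  refine Submodule.disjoint_def.mp h v hv ?_
  refine (iSup₂_le fun nu hnu => ?_ : (⨆ nu, ⨆ _ : T nu, GlobalWeyl.weightSpace V nu) ≤ _) hv'
  exact le_iSup₂_of_le (f := fun (nu : Module.Dual ℂ H) (_ : nu ≠ mu) =>
    GlobalWeyl.weightSpace V nu) nu (fun h => hT (h ▸ hnu)) le_rfl

/-- A root vector acting locally finitely on a weight vector is nilpotent on it, since its powers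
move the vector to different weight spaces. -/
theorem exists_pow_eq_zero_of_mem_locFinPart {chi mu : Module.Dual ℂ H} (hchi : chi ≠ 0) {x : L}
    (hx : x ∈ LieAlgebra.rootSpace H (chi : H → ℂ)) {v : V}
    (hv : v ∈ GlobalWeyl.weightSpace V mu) (hv' : v ∈ locFinPart V {x}) :
    ∃ k, (toEnd ℂ L V x ^ k) v = 0 := by
  by_contra! hne
  obtain ⟨F, hvF, hfd, hst⟩ := hv'
  have hinj : Function.Injective fun k : ℕ => mu + k • chi := fun k l hkl => by
    have : (k : ℂ) • chi = (l : ℂ) • chi := by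
      simpa [Nat.cast_smul_eq_nsmul] using hkl
    exact_mod_cast smul_left_injective ℂ hchi this
  have hli := ((iSupIndep_weightSpace H V).comp hinj).linearIndependent _
    (fun k => pow_mem_weightSpace hx hv k) hne
  have hmem : ∀ k, (toEnd ℂ L V x ^ k) v ∈ F := fun k => by
    induction k with
    | zero => simpa using hvF
    | succ k ih => rw [pow_succ']; exact hst x rfl _ ih
  -- infinitely many nonzero vectors of distinct weights in a finite-dimensional space
  have hli2 : LinearIndependent ℂ (fun k : ℕ => (⟨_, hmem k⟩ : F)) :=
    LinearIndependent.of_comp F.subtype hli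
  exact not_finite_iff_infinite.mpr inferInstance hli2.finite

end WeightSpaces

/-! ### Highest weight modules and the triangular decomposition -/

section HighestWeight

open LieModule
open scoped ModuleCat

variable {L : Type u} [LieRing L] [LieAlgebra ℂ L] [FiniteDimensional ℂ L] [LieAlgebra.IsSimple ℂ L]
  {H : LieSubalgebra ℂ L} [H.IsCartanSubalgebra] {A : Type u} [CommRing A] [Algebra ℂ A]
  {V : ModuleCat.{u} (Env A L)}
  (b : (LieAlgebra.IsKilling.rootSystem H).Base)

attribute [local instance] curLieRingModule curLieModule

local notation "Φ" => RootPairing.root (LieAlgebra.IsKilling.rootSystem H)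

/-- The height functional: `Q⁺` takes values in `ℕ` and only `0` has height `0`. -/
theorem exists_height :
    ∃ ht : Module.Dual ℂ (Module.Dual ℂ H), ∀ nu ∈ Qplus b,
      ∃ n : ℕ, ht nu = n ∧ (n = 0 → nu = 0) := by
  refine ⟨b.toWeightBasis.constr ℂ fun _ => 1, fun nu hnu => ?_⟩
  induction hnu using AddSubmonoid.closure_induction with
  | mem x hx =>
    obtain ⟨i, hi, rfl⟩ := hx
    refine ⟨1, ?_, by simp⟩
    have := b.toWeightBasis.constr_basis ℂ (fun _ => (1 : ℂ)) ⟨i, hi⟩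
    rw [b.toWeightBasis_apply] at this
    simpa using this
  | zero => exact ⟨0, by simp⟩
  | add x y _ _ hx hy =>
    obtain ⟨n, hn, hn0⟩ := hx
    obtain ⟨m, hm, hm0⟩ := hy
    refine ⟨n + m, by rw [map_add, hn, hm]; push_cast; rfl, fun h => ?_⟩
    rw [hn0 (by omega), hm0 (by omega), add_zero]

theorem eq_zero_of_mem_Qplus_of_neg_mem {nu : Module.Dual ℂ H} (h : nu ∈ Qplus b)
    (h' : -nu ∈ Qplus b) : nu = 0 := by
  obtain ⟨ht, hht⟩ := exists_height b
  obtain ⟨n, hn, hn0⟩ := hht _ h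
  obtain ⟨m, hm, -⟩ := hht _ h'
  refine hn0 ?_
  rw [map_neg, hn] at hm
  have : ((n + m : ℕ) : ℂ) = 0 := by push_cast; rw [← hm]; ring
  have := Nat.cast_eq_zero.mp this
  omega

/-- The cone `Q⁺` contains no half-line in the direction `-nu` for `0 ≠ nu ∈ Q⁺`. -/
theorem exists_sub_nsmul_notMem_Qplus {nu : Module.Dual ℂ H} (h : nu ∈ Qplus b) (h0 : nu ≠ 0)
    (xi : Module.Dual ℂ H) : ∃ k : ℕ, xi - k • nu ∉ Qplus b := by
  by_contra! hcon
  obtain ⟨ht, hht⟩ := exists_height b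
  obtain ⟨n, hn, hn0⟩ := hht _ h
  obtain ⟨m, hm, -⟩ := hht _ (by simpa using hcon 0)
  obtain ⟨p, hp, -⟩ := hht _ (hcon (m + 1))
  have hn1 : 1 ≤ n := Nat.one_le_iff_ne_zero.mpr fun h => h0 (hn0 h)
  rw [map_sub, map_nsmul, hn, hm, nsmul_eq_mul, sub_eq_iff_eq_add] at hp
  have hp' : m = p + (m + 1) * n := by exact_mod_cast hp
  nlinarith

theorem root_ne_zero (α : H.root) : Φ α ≠ 0 :=
  (LieAlgebra.IsKilling.rootSystem H).ne_zero α

/-- `𝔤` is spanned by the Cartan subalgebra and the root vectors. -/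
theorem mem_of_cartan_of_root (P : Submodule ℂ L) (hH : ∀ h : H, (h : L) ∈ P)
    (hroot : ∀ α : H.root, ∀ x ∈ LieAlgebra.rootSpace H (Φ α : H → ℂ), x ∈ P) (x : L) :
    x ∈ P := by
  have h := LieAlgebra.cartan_sup_iSup_rootSpace_eq_top (K := ℂ) H
  have h2 := congrArg (fun N : LieSubmodule ℂ H L => (N : Submodule ℂ L)) h
  simp only [LieSubmodule.sup_toSubmodule, LieSubmodule.iSup_toSubmodule,
    LieSubmodule.top_toSubmodule] at h2
  refine (h2.symm.le.trans (sup_le (fun y hy => hH ⟨y, hy⟩) (iSup₂_le fun α hα y hy => ?_)) :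
    (⊤ : Submodule ℂ L) ≤ P) trivial
  exact hroot ⟨α, by simpa using hα⟩ y hy

/-- An `𝔥`-weight vector of `𝔤` is zero, lies in `𝔥`, or is a root vector. -/
theorem rootSpace_cases {χ : H → ℂ} {x : L} (hx : x ∈ LieAlgebra.rootSpace H χ) :
    x = 0 ∨ x ∈ H ∨ ∃ α : H.root, x ∈ LieAlgebra.rootSpace H (Φ α : H → ℂ) := by
  by_cases hx0 : x = 0
  · exact Or.inl hx0
  · by_cases hχ : χ = 0
    · subst hχ
      rw [LieAlgebra.rootSpace_zero_eq ℂ L H] at hx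
      exact Or.inr (Or.inl hx)
    · refine Or.inr (Or.inr ?_)
      have hne : LieModule.genWeightSpace L χ ≠ ⊥ := fun h => hx0 (by
        simpa using (h.le hx : x ∈ (⊥ : LieSubmodule ℂ H L)))
      exact ⟨⟨⟨χ, hne⟩, Finset.mem_filter.mpr ⟨Finset.mem_univ _, fun h => hχ h⟩⟩, hx⟩

theorem lie_mem_rootSpace {χ ψ : H → ℂ} {x y : L} (hx : x ∈ LieAlgebra.rootSpace H χ)
    (hy : y ∈ LieAlgebra.rootSpace H ψ) : ⁅x, y⁆ ∈ LieAlgebra.rootSpace H (χ + ψ) :=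
  LieAlgebra.lie_mem_genWeightSpace_of_mem_genWeightSpace hx hy

theorem mem_rootSpace_zero (h : H) : (h : L) ∈ LieAlgebra.rootSpace H (0 : H → ℂ) := by
  rw [LieAlgebra.rootSpace_zero_eq ℂ L H]; exact h.2

theorem cur_smul_cur_smul (a c : A) (x y : L) (v : V) :
    (cur a x : Env A L) • (cur c y : Env A L) • v =
      (cur c y : Env A L) • (cur a x : Env A L) • v + (cur (a * c) ⁅x, y⁆ : Env A L) • v := by
  rw [← mul_smul, cur_mul_cur, add_smul, mul_smul]

/-- The action of `𝔤 ⊗ a` on `v`, as a linear map in the element of `𝔤`. -/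
def curSMul (a : A) (v : V) : L →ₗ[ℂ] V where
  toFun x := (cur a x : Env A L) • v
  map_add' x y := by rw [cur_add, add_smul]
  map_smul' z x := by rw [cur_smul, smul_assoc]; rfl

/-- The vectors `U(𝔥 ⊗ A) w`. -/
def cartanSpan (H : LieSubalgebra ℂ L) [H.IsCartanSubalgebra] (w : V) : Submodule ℂ V where
  carrier := {v | ∃ u : Env A H, v = cartanIncl H A u • w}
  zero_mem' := ⟨0, by simp⟩
  add_mem' := by
    rintro _ _ ⟨u, rfl⟩ ⟨v, rfl⟩
    exact ⟨u + v, by rw [map_add, add_smul]⟩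
  smul_mem' := by
    rintro z _ ⟨u, rfl⟩
    exact ⟨z • u, by rw [map_smul, smul_assoc]⟩

variable {b} in
/-- If `w` is killed by `𝔫⁺ ⊗ A`, so is `U(𝔥 ⊗ A) w`. -/
theorem raising_smul_cartanSpan {w : V}
    (hraise : ∀ α : H.root, Φ α ∈ Qplus b →
      ∀ x ∈ LieAlgebra.rootSpace H (Φ α : H → ℂ), ∀ a : A, (cur a x : Env A L) • w = 0)
    {v : V} (hv : v ∈ cartanSpan H w) (α : H.root) (hα : Φ α ∈ Qplus b) (x : L)
    (hx : x ∈ LieAlgebra.rootSpace H (Φ α : H → ℂ)) (a : A) :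
    (cur a x : Env A L) • v = 0 := by
  obtain ⟨u, rfl⟩ := hv
  let P : Submodule ℂ V :=
    { carrier := {v | ∀ x ∈ LieAlgebra.rootSpace H (Φ α : H → ℂ), ∀ a : A,
        (cur a x : Env A L) • v = 0}
      zero_mem' := fun x _ a => smul_zero _
      add_mem' := fun {v w} hv hw x hx a => by rw [smul_add, hv x hx a, hw x hx a, add_zero]
      smul_mem' := fun z v hv x hx a => by rw [smul_comm, hv x hx a, smul_zero] }
  refine cartanIncl_smul_mem P (fun c h v hv x hx a => ?_) u w (fun x hx a => hraise α hα x hx a)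
    x hx a
  rw [cur_smul_cur_smul, hv x hx a, smul_zero, zero_add]
  refine hv _ ?_ _
  have := lie_mem_rootSpace hx (mem_rootSpace_zero h)
  rwa [add_zero] at this

/-- The triangular decomposition `U(𝔤 ⊗ A) w = U(𝔫⁻ ⊗ A) U(𝔥 ⊗ A) w` for a highest weight vector
`w`, in terms of weights: a module generated by `w` is the sum of `U(𝔥 ⊗ A) w` and of weight spaces
of weights strictly below `lam`. -/
theorem mem_cartanSpan_sup_iSup_weightSpace {lam : Module.Dual ℂ H} {w : V}
    (hraise : ∀ α : H.root, Φ α ∈ Qplus b →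
      ∀ x ∈ LieAlgebra.rootSpace H (Φ α : H → ℂ), ∀ a : A, (cur a x : Env A L) • w = 0)
    (hw : w ∈ GlobalWeyl.weightSpace V lam) (hgen : ∀ v : V, ∃ u : Env A L, v = u • w) (v : V) :
    v ∈ cartanSpan H w ⊔ ⨆ mu : Module.Dual ℂ H, ⨆ _ : lam - mu ∈ Qplus b ∧ mu ≠ lam,
      GlobalWeyl.weightSpace V mu := by
  -- `Neg P` says that `P` contains `U(𝔥 ⊗ A) w` and is stable under `𝔫⁻ ⊗ A`
  let Neg (P : Submodule ℂ V) : Prop := cartanSpan H w ≤ P ∧ ∀ α : H.root, -Φ α ∈ Qplus b →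
    ∀ x ∈ LieAlgebra.rootSpace H (Φ α : H → ℂ), ∀ a : A, ∀ v ∈ P, (cur a x : Env A L) • v ∈ P
  let D : Submodule ℂ V := sInf {P | Neg P}
  have hDle : ∀ {P}, Neg P → D ≤ P := fun {P} hP => sInf_le hP
  have hD : Neg D := by
    refine ⟨le_sInf fun P hP => hP.1, fun α hα x hx a v hv => ?_⟩
    rw [Submodule.mem_sInf] at hv ⊢
    exact fun P hP => hP.2 α hα x hx a v (hv P hP)
  -- `D` is stable under `(𝔥 ⊕ 𝔫⁺) ⊗ A`
  let Bor (x : L) : Prop := x ∈ H ∨ ∃ α : H.root, Φ α ∈ Qplus b ∧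
    x ∈ LieAlgebra.rootSpace H (Φ α : H → ℂ)
  have hBorD : ∀ v ∈ D, ∀ x, Bor x → ∀ a : A, (cur a x : Env A L) • v ∈ D := by
    let P : Submodule ℂ V :=
      { carrier := {v | v ∈ D ∧ ∀ x, Bor x → ∀ a : A, (cur a x : Env A L) • v ∈ D}
        zero_mem' := ⟨D.zero_mem, fun x _ a => by rw [smul_zero]; exact D.zero_mem⟩
        add_mem' := fun {v w} hv hw => ⟨D.add_mem hv.1 hw.1, fun x hx a => by
          rw [smul_add]; exact D.add_mem (hv.2 x hx a) (hw.2 x hx a)⟩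
        smul_mem' := fun z v hv => ⟨D.smul_mem z hv.1, fun x hx a => by
          rw [smul_comm]; exact D.smul_mem z (hv.2 x hx a)⟩ }
    suffices Neg P from fun v hv => (hDle this hv).2
    refine ⟨fun v hv => ⟨hD.1 hv, ?_⟩, fun α hα y hy c v hv => ⟨hD.2 α hα y hy c v hv.1, ?_⟩⟩
    · rintro x (hx | ⟨α, hα, hx⟩) a
      · obtain ⟨u, rfl⟩ := hv
        refine hD.1 ⟨cur a ⟨x, hx⟩ * u, ?_⟩
        rw [map_mul, cartanIncl_cur, mul_smul]
      · rw [raising_smul_cartanSpan hraise hv α hα x hx a]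
        exact D.zero_mem
    · intro x hx a
      rw [cur_smul_cur_smul]
      refine D.add_mem (hD.2 α hα y hy c _ (hv.2 x hx a)) ?_
      obtain ⟨χ, hχ⟩ : ∃ χ : H → ℂ, x ∈ LieAlgebra.rootSpace H χ := by
        rcases hx with hx | ⟨α, -, hx⟩
        exacts [⟨0, mem_rootSpace_zero ⟨x, hx⟩⟩, ⟨_, hx⟩]
      rcases rootSpace_cases (lie_mem_rootSpace hχ hy) with h | h | ⟨β, h⟩
      · rw [h, cur_zero, zero_smul]; exact D.zero_mem
      · exact hv.2 _ (Or.inl h) _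
      · rcases b.root_mem_or_neg_mem β with hβ | hβ
        · exact hv.2 _ (Or.inr ⟨β, hβ, h⟩) _
        · exact hD.2 β hβ _ h _ _ hv.1
  have hDcur : ∀ (a : A) (x : L), ∀ v ∈ D, (cur a x : Env A L) • v ∈ D := by
    intro a x v hv
    refine mem_of_cartan_of_root (D.comap (curSMul a v)) (fun h => hBorD v hv _ (Or.inl h.2) a)
      (fun α y hy => ?_) x
    rcases b.root_mem_or_neg_mem α with hα | hα
    · exact hBorD v hv _ (Or.inr ⟨α, hα, hy⟩) a
    · exact hD.2 α hα y hy a v hv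
  have hwX : w ∈ cartanSpan H w := ⟨1, by simp⟩
  have hvD : v ∈ D := by
    obtain ⟨u, rfl⟩ := hgen v
    exact env_smul_mem D hDcur u w (hD.1 hwX)
  refine hDle ⟨le_sup_left, fun α hα x hx a v hv => Submodule.mem_sup_right ?_⟩ hvD
  have hα0 : Φ α ≠ 0 := root_ne_zero α
  let N : Submodule ℂ V := ⨆ mu : Module.Dual ℂ H, ⨆ _ : lam - mu ∈ Qplus b ∧ mu ≠ lam,
      GlobalWeyl.weightSpace V mu
  -- a negative root vector moves weights `≤ lam` to weights `< lam`
  have hlow : ∀ mu, lam - mu ∈ Qplus b → ∀ p ∈ GlobalWeyl.weightSpace V mu,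
      (cur a x : Env A L) • p ∈ N := by
    intro mu hmu p hp
    have h1 : lam - (mu + Φ α) = (lam - mu) + -Φ α := by abel
    refine Submodule.mem_iSup_of_mem (mu + Φ α) (Submodule.mem_iSup_of_mem
      ⟨h1 ▸ add_mem hmu hα, fun h => hα0 ?_⟩ (cur_smul_mem_weightSpace hx a hp))
    refine eq_zero_of_mem_Qplus_of_neg_mem b ?_ hα
    rwa [← h, add_sub_cancel_left] at hmu
  obtain ⟨p, hp, q, hq, rfl⟩ := Submodule.mem_sup.mp hv
  rw [smul_add]
  refine N.add_mem (hlow lam (by simp) p ?_) ?_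
  · obtain ⟨u, rfl⟩ := hp
    exact cartanIncl_smul_mem (GlobalWeyl.weightSpace V lam)
      (fun a h v hv => cur_cartan_smul_mem_weightSpace h a hv) u w hw
  · let f : V →ₗ[ℂ] V :=
      { toFun := fun v => (cur a x : Env A L) • v
        map_add' := smul_add _
        map_smul' := fun z v => smul_comm _ _ _ }
    exact (iSup₂_le fun mu hmu p hp => hlow mu hmu.1 p hp : N ≤ N.comap f) hq

end HighestWeight

/-! ### Weyl group symmetry of the weights and integrability -/

section Integrable

open LieModule
open scoped ModuleCat

variable {L : Type u} [LieRing L] [LieAlgebra ℂ L] [FiniteDimensional ℂ L] [LieAlgebra.IsSimple ℂ L]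
  {H : LieSubalgebra ℂ L} [H.IsCartanSubalgebra] {A : Type u} [CommRing A] [Algebra ℂ A]
  {V : ModuleCat.{u} (Env A L)}
  (b : (LieAlgebra.IsKilling.rootSystem H).Base)

attribute [local instance] curLieRingModule curLieModule

local notation "Φ" => RootPairing.root (LieAlgebra.IsKilling.rootSystem H)

/-- In a module spanned by weight spaces of weights in `lam - Q⁺`, all weights lie in
`lam - Q⁺`. -/
theorem sub_mem_Qplus_of_weightSpace_ne_bot {lam : Module.Dual ℂ H}
    (h : ∀ v : V, v ∈ ⨆ mu : Module.Dual ℂ H, ⨆ _ : lam - mu ∈ Qplus b,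
      GlobalWeyl.weightSpace V mu) {mu : Module.Dual ℂ H}
    (hmu : GlobalWeyl.weightSpace V mu ≠ ⊥) : lam - mu ∈ Qplus b := by
  by_contra hcon
  obtain ⟨v, hv, hv0⟩ := (Submodule.ne_bot_iff _).mp hmu
  exact hv0 (eq_zero_of_mem_weightSpace_of_mem_iSup (T := fun nu => lam - nu ∈ Qplus b) hcon hv
    (h v))

variable (V) in
/-- One half of the `sl₂`-string argument: raise to a primitive vector, then lower it. -/
theorem exists_string_weightSpace_ne_bot {h : H} {e f : L} (t : IsSl2Triple (h : L) e f)
    {chi mu : Module.Dual ℂ H} (hchi : chi ≠ 0)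
    (he : e ∈ LieAlgebra.rootSpace H (chi : H → ℂ))
    (hf : f ∈ LieAlgebra.rootSpace H ((-chi : Module.Dual ℂ H) : H → ℂ))
    (heV : locFinPart V {e} = ⊤) (hfV : locFinPart V {f} = ⊤)
    (hmu : GlobalWeyl.weightSpace V mu ≠ ⊥) :
    ∃ p n : ℕ, mu h + 2 * p = n ∧
      ∀ j ≤ n, GlobalWeyl.weightSpace V (mu + p • chi + j • -chi) ≠ ⊥ := by
  obtain ⟨v, hv, hv0⟩ := (Submodule.ne_bot_iff _).mp hmu
  obtain ⟨p, n, hpn, hj⟩ := exists_raise_lower_ne_zero t hv0 (hv h)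
    (exists_pow_eq_zero_of_mem_locFinPart hchi he hv (heV ▸ trivial))
    (fun p => exists_pow_eq_zero_of_mem_locFinPart (neg_ne_zero.mpr hchi) hf
      (pow_mem_weightSpace he hv p) (hfV ▸ trivial))
  exact ⟨p, n, hpn, fun j hjn => (Submodule.ne_bot_iff _).mpr
    ⟨_, pow_mem_weightSpace hf (pow_mem_weightSpace he hv p) j, hj j hjn⟩⟩

variable (V) in
/-- If the root vectors of `±α` act locally finitely, the set of weights is stable under the
reflection in `α`. -/
theorem weightSpace_reflection_ne_bot (α : H.root)
    (hpos : ∀ x ∈ LieAlgebra.rootSpace H (Φ α : H → ℂ), locFinPart V {x} = ⊤)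
    (hneg : ∀ x ∈ LieAlgebra.rootSpace H (-(Φ α : H → ℂ)), locFinPart V {x} = ⊤)
    {mu : Module.Dual ℂ H} (hmu : GlobalWeyl.weightSpace V mu ≠ ⊥) :
    GlobalWeyl.weightSpace V ((LieAlgebra.IsKilling.rootSystem H).reflection α mu) ≠ ⊥ := by
  have hα0 : Φ α ≠ 0 := root_ne_zero α
  have hα : (α : LieModule.Weight ℂ H L).IsNonZero := H.isNonZero_coe_root α
  obtain ⟨k, e, f, t, he, hf⟩ := LieAlgebra.IsKilling.exists_isSl2Triple_of_weight_isNonZero hα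
  have hk := t.h_eq_coroot hα he hf
  subst hk
  have hc : (LieAlgebra.IsKilling.rootSystem H).coroot' α mu =
    mu (LieAlgebra.IsKilling.coroot (α : LieModule.Weight ℂ H L)) := rfl
  rw [RootPairing.reflection_apply, hc]
  obtain ⟨p, n, hpn, hj⟩ :=
    exists_string_weightSpace_ne_bot V t hα0 he hf (hpos e he) (hneg f hf) hmu
  rcases le_or_gt p n with hle | hlt
  · have h1 := hj (n - p) (Nat.sub_le _ _)
    rw [← Nat.cast_smul_eq_nsmul ℂ, ← Nat.cast_smul_eq_nsmul ℂ, Nat.cast_sub hle, ← hpn] at h1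
    convert h1 using 2
    module
  -- here `mu` is negative on the coroot, and the string is followed from the other end
  · obtain ⟨q, m, hqm, hj'⟩ := exists_string_weightSpace_ne_bot V
      (h := -LieAlgebra.IsKilling.coroot (α : LieModule.Weight ℂ H L)) t.symm
      (neg_ne_zero.mpr hα0) hf (by rw [neg_neg]; exact he) (hneg f hf) (hpos e he) hmu
    rw [map_neg] at hqm
    have hle : q ≤ m := by
      have h1 : (n + m : ℂ) = 2 * p + 2 * q := by rw [← hpn, ← hqm]; ring
      have h2 : n + m = 2 * p + 2 * q := by exact_mod_cast h1
      omega
    have h1 := hj' (m - q) (Nat.sub_le _ _)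
    rw [← Nat.cast_smul_eq_nsmul ℂ, ← Nat.cast_smul_eq_nsmul ℂ, Nat.cast_sub hle, ← hqm] at h1
    convert h1 using 2
    module

/-- A module generated by a highest weight vector `w` which is killed by powers of the simple
lowering operators is locally finite over `𝔤`. -/
theorem isLocallyFinite_of_generator {lam : Module.Dual ℂ H} {w : V}
    (hraise : ∀ α : H.root, Φ α ∈ Qplus b →
      ∀ x ∈ LieAlgebra.rootSpace H (Φ α : H → ℂ), ∀ a : A, (cur a x : Env A L) • w = 0)
    (hw : w ∈ GlobalWeyl.weightSpace V lam)
    (hlower : ∀ i ∈ b.support, ∀ x ∈ LieAlgebra.rootSpace H (-(Φ i : H → ℂ)),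
      ∃ n, (toEnd ℂ L V x ^ n) w = 0)
    (hgen : ∀ v : V, ∃ u : Env A L, v = u • w) : IsLocallyFinite V := by
  have htop : ∀ S : Set L, w ∈ locFinPart V S → locFinPart V S = ⊤ := fun S hS => by
    rw [Submodule.eq_top_iff']
    intro v
    obtain ⟨u, rfl⟩ := hgen v
    exact env_smul_mem _ (cur_smul_mem_locFinPart S) u w hS
  -- `Ω mu` says that `mu` is a weight of `V`
  let Ω (mu : Module.Dual ℂ H) : Prop := GlobalWeyl.weightSpace V mu ≠ ⊥
  have hΩ : ∀ {mu}, Ω mu → lam - mu ∈ Qplus b := fun {mu} hmu => by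
    refine sub_mem_Qplus_of_weightSpace_ne_bot b (fun v => ?_) hmu
    refine (sup_le (fun p hp => ?_) (iSup₂_le fun nu hnu => ?_) : cartanSpan H w ⊔ _ ≤ _)
      (mem_cartanSpan_sup_iSup_weightSpace b hraise hw hgen v)
    · refine Submodule.mem_iSup_of_mem lam (Submodule.mem_iSup_of_mem (by simp) ?_)
      obtain ⟨u, rfl⟩ := hp
      exact cartanIncl_smul_mem (GlobalWeyl.weightSpace V lam)
        (fun a h v hv => cur_cartan_smul_mem_weightSpace h a hv) u w hw
    · exact le_iSup₂_of_le (f := fun (nu : Module.Dual ℂ H) (_ : lam - nu ∈ Qplus b) =>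
        GlobalWeyl.weightSpace V nu) nu hnu.1 le_rfl
  have hrefl : ∀ i ∈ b.support, ∀ mu, Ω mu →
      Ω ((LieAlgebra.IsKilling.rootSystem H).reflection i mu) := fun i hi mu hmu => by
    refine weightSpace_reflection_ne_bot V i (fun x hx => htop _ ?_) (fun x hx => htop _ ?_) hmu
    · refine mem_locFinPart_of_pow_eq_zero (n := 1) ?_
      rw [pow_one]
      exact hraise i (AddSubmonoid.subset_closure ⟨i, hi, rfl⟩) x hx 1
    · obtain ⟨n, hn⟩ := hlower i hi x hx
      exact mem_locFinPart_of_pow_eq_zero hn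
  -- no weight string is infinite in the direction of a root
  have hstring : ∀ β : H.root, (∀ mu, Ω mu → ∃ k : ℕ, ¬ Ω (mu + k • Φ β)) ∧
      (∀ mu, Ω mu → ∃ k : ℕ, ¬ Ω (mu + k • -Φ β)) := by
    intro β
    refine RootPairing.Base.induction_reflect (b := b) β
      (p := fun β => (∀ mu, Ω mu → ∃ k : ℕ, ¬ Ω (mu + k • Φ β)) ∧
        (∀ mu, Ω mu → ∃ k : ℕ, ¬ Ω (mu + k • -Φ β))) ?_ ?_ ?_
    · intro i hi
      rw [RootPairing.root_reflectionPerm, RootPairing.reflection_apply_self, neg_neg]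
      exact hi.symm
    · intro i hi
      have h1 : ∀ mu, Ω mu → ∃ k : ℕ, ¬ Ω (mu + k • Φ i) := fun mu hmu => by
        obtain ⟨k, hk⟩ := exists_sub_nsmul_notMem_Qplus b
          (AddSubmonoid.subset_closure ⟨i, hi, rfl⟩) (root_ne_zero i) (lam - mu)
        exact ⟨k, fun h => hk (by rw [sub_sub]; exact hΩ h)⟩
      refine ⟨h1, fun mu hmu => ?_⟩
      obtain ⟨k, hk⟩ := h1 _ (hrefl i hi mu hmu)
      refine ⟨k, fun h => hk ?_⟩
      have := hrefl i hi _ h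
      rwa [map_add, map_nsmul, map_neg, RootPairing.reflection_apply_self, neg_neg] at this
    · rintro i j ⟨h1, h2⟩ hj
      refine ⟨fun mu hmu => ?_, fun mu hmu => ?_⟩
      · obtain ⟨k, hk⟩ := h1 _ (hrefl j hj mu hmu)
        refine ⟨k, fun h => hk ?_⟩
        have := hrefl j hj _ h
        rwa [RootPairing.root_reflectionPerm, map_add, map_nsmul, RootPairing.reflection_same]
          at this
      · obtain ⟨k, hk⟩ := h2 _ (hrefl j hj mu hmu)
        refine ⟨k, fun h => hk ?_⟩
        have := hrefl j hj _ h
        rwa [RootPairing.root_reflectionPerm, map_add, map_nsmul, map_neg,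
          RootPairing.reflection_same] at this
  have hroot : ∀ β : H.root, ∀ x ∈ LieAlgebra.rootSpace H (Φ β : H → ℂ),
      w ∈ locFinPart V {x} := fun β x hx => by
    by_cases h0 : w = 0
    · rw [h0]; exact Submodule.zero_mem _
    · obtain ⟨k, hk⟩ := (hstring β).1 lam ((Submodule.ne_bot_iff _).mpr ⟨w, hw, h0⟩)
      refine mem_locFinPart_of_pow_eq_zero (n := k) ?_
      have := pow_mem_weightSpace hx hw k
      rwa [not_not.mp hk, Submodule.mem_bot] at this
  let T : Set L := {x | w ∈ locFinPart V {x}}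
  have hT : Submodule.span ℂ T = ⊤ := by
    rw [Submodule.eq_top_iff']
    refine mem_of_cartan_of_root _ (fun h => Submodule.subset_span ?_)
      (fun β x hx => Submodule.subset_span (hroot β x hx))
    refine ⟨ℂ ∙ w, Submodule.mem_span_singleton_self w, inferInstance, ?_⟩
    rintro _ rfl v hv
    obtain ⟨z, rfl⟩ := Submodule.mem_span_singleton.mp hv
    rw [smul_comm, hw h]
    exact Submodule.smul_mem _ _ (Submodule.smul_mem _ _ (Submodule.mem_span_singleton_self w))
  -- elements of `T` act locally finitely on `V` and span `𝔤`; a basis is extracted from them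
  obtain ⟨x, hxT, hx, -⟩ := Submodule.exists_fun_fin_finrank_span_eq ℂ T
  refine exists_finiteDimensional_stable x (hx.trans hT) fun i v => ?_
  obtain ⟨F, hv, hfd, hst⟩ := (htop _ (hxT i)).symm.le (Submodule.mem_top (x := v))
  exact ⟨F, hv, hfd, hst _ rfl⟩

end Integrable

/-! ### The top weight space in `I_A^lam` -/

section TopWeight

open LieModule
open scoped ModuleCat

variable {L : Type u} [LieRing L] [LieAlgebra ℂ L] [FiniteDimensional ℂ L] [LieAlgebra.IsSimple ℂ L]
  {H : LieSubalgebra ℂ L} [H.IsCartanSubalgebra] {A : Type u} [CommRing A] [Algebra ℂ A]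
  {V : ModuleCat.{u} (Env A L)}
  {b : (LieAlgebra.IsKilling.rootSystem H).Base} {lam : Module.Dual ℂ H}

attribute [local instance] curLieRingModule curLieModule

local notation "Φ" => RootPairing.root (LieAlgebra.IsKilling.rootSystem H)

theorem map_mem_weightSpace {V' : ModuleCat.{u} (Env A L)} (g : V →ₗ[Env A L] V')
    {mu : Module.Dual ℂ H} {v : V} (hv : v ∈ GlobalWeyl.weightSpace V mu) :
    g v ∈ GlobalWeyl.weightSpace V' mu := fun h => by
  rw [← map_smul, hv h]
  exact (g.restrictScalars ℂ).map_smul (mu h) v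

theorem map_mem_locFinPart {V' : ModuleCat.{u} (Env A L)} (g : V →ₗ[Env A L] V') {S : Set L}
    {v : V} (hv : v ∈ locFinPart V S) : g v ∈ locFinPart V' S := by
  obtain ⟨F, hvF, hfd, hst⟩ := hv
  refine ⟨F.map (g.restrictScalars ℂ), ⟨v, hvF, rfl⟩, inferInstance, ?_⟩
  rintro x hx _ ⟨w, hw, rfl⟩
  exact ⟨_, hst x hx w hw, map_smul g _ _⟩

theorem map_mem_iSup_weightSpace {V' : ModuleCat.{u} (Env A L)} (g : V →ₗ[Env A L] V')
    {T : Module.Dual ℂ H → Prop} {v : V}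
    (hv : v ∈ ⨆ mu, ⨆ _ : T mu, GlobalWeyl.weightSpace V mu) :
    g v ∈ ⨆ mu, ⨆ _ : T mu, GlobalWeyl.weightSpace V' mu := by
  refine (iSup₂_le fun mu hmu v hv => ?_ : (⨆ mu, ⨆ _ : T mu, GlobalWeyl.weightSpace V mu) ≤
    (⨆ mu, ⨆ _ : T mu, GlobalWeyl.weightSpace V' mu).comap (g.restrictScalars ℂ)) hv
  exact Submodule.mem_iSup_of_mem mu (Submodule.mem_iSup_of_mem hmu (map_mem_weightSpace g hv))

theorem exists_lieSubmodule_of_isLocallyFinite (hV : IsLocallyFinite V) (v : V) :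
    ∃ F : LieSubmodule ℂ L V, v ∈ F ∧ FiniteDimensional ℂ F := by
  obtain ⟨F, hv, hfd, hst⟩ := hV v
  exact ⟨{ F with lie_mem := fun {x w} hw => hst x w hw }, hv, hfd⟩

/-- `lam` is a maximal weight: `lam + α` is not a weight for a positive root `α`. -/
theorem weightSpace_add_root_eq_bot (hV : weylProp A b lam V) {α : H.root} (hα : Φ α ∈ Qplus b) :
    GlobalWeyl.weightSpace V (lam + Φ α) = ⊥ := by
  by_contra h
  have h1 := hV.2 _ h
  rw [sub_add_cancel_left] at h1
  exact root_ne_zero α (eq_zero_of_mem_Qplus_of_neg_mem b hα h1)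

/-- Positive root vectors kill the generalized weight space of the top weight. -/
theorem lie_eq_zero_of_mem_genWeightSpace (hV : weylProp A b lam V) (F : LieSubmodule ℂ L V)
    [FiniteDimensional ℂ F] {v : F} (hv : v ∈ genWeightSpace F (lam : H → ℂ)) {α : H.root}
    (hα : Φ α ∈ Qplus b) {e : L} (he : e ∈ LieAlgebra.rootSpace H (Φ α : H → ℂ)) :
    ⁅e, v⁆ = 0 := by
  have h1 : ⁅e, v⁆ ∈ genWeightSpace F ((Φ α : H → ℂ) + (lam : H → ℂ)) :=
    LieAlgebra.lie_mem_genWeightSpace_of_mem_genWeightSpace he hv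
  by_contra hne
  have hbot : genWeightSpace F ((Φ α : H → ℂ) + (lam : H → ℂ)) ≠ ⊥ := fun h => by
    rw [h, LieSubmodule.mem_bot] at h1
    exact hne h1
  obtain ⟨u, hu0, hu⟩ := LieModule.exists_forall_lie_eq_smul ℂ H F ⟨_, hbot⟩
  have hmem : (u : V) ∈ GlobalWeyl.weightSpace V (lam + Φ α) := fun h => by
    rw [add_comm]
    exact congrArg Subtype.val (hu h)
  rw [weightSpace_add_root_eq_bot hV hα, Submodule.mem_bot] at hmem
  exact hu0 (Subtype.ext hmem)

/-- The generalized weight space of the top weight `lam` consists of weight vectors: the simple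
raising operators vanish there, so `sl₂`-theory applies to each simple coroot. -/
theorem mem_weightSpace_of_mem_genWeightSpace (hV : weylProp A b lam V) (F : LieSubmodule ℂ L V)
    [FiniteDimensional ℂ F] {v : F} (hv : v ∈ genWeightSpace F (lam : H → ℂ)) :
    (v : V) ∈ GlobalWeyl.weightSpace V lam := by
  by_cases hv0 : v = 0
  · rw [hv0]; exact Submodule.zero_mem _
  have hcoroot : ∀ i ∈ b.support,
      ⁅((LieAlgebra.IsKilling.rootSystem H).coroot i : H), v⁆ =
        lam ((LieAlgebra.IsKilling.rootSystem H).coroot i) • v := by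
    intro i hi
    have hi0 : (i : LieModule.Weight ℂ H L).IsNonZero := H.isNonZero_coe_root i
    obtain ⟨k, e, f, t, he, hf⟩ := LieAlgebra.IsKilling.exists_isSl2Triple_of_weight_isNonZero hi0
    have hk := t.h_eq_coroot hi0 he hf
    subst hk
    have hev : ⁅e, v⁆ = 0 := lie_eq_zero_of_mem_genWeightSpace hV F hv
      (AddSubmonoid.subset_closure ⟨i, hi, rfl⟩) he
    obtain ⟨n, hn⟩ := isNilpotent_toEnd_of_mem_rootSpace (M := F) H
      (neg_ne_zero.mpr fun h => hi0 h) hf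
    refine (lie_eq_smul_of_mem_maxGenEigenspace t (n := n) hev (by rw [hn]; rfl) ?_ hv0).1
    have h2 := genWeightSpace_le_genWeightSpaceOf F
      (LieAlgebra.IsKilling.coroot (i : LieModule.Weight ℂ H L)) (lam : H → ℂ) hv
    exact h2
  intro h
  have hspan : h ∈ Submodule.span ℂ ((LieAlgebra.IsKilling.rootSystem H).coroot '' b.support) := by
    rw [b.span_coroot_support]
    have := RootPairing.IsRootSystem.span_coroot_eq_top (P := LieAlgebra.IsKilling.rootSystem H)
    rw [RootPairing.corootSpan, this]; trivial
  induction hspan using Submodule.span_induction with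
  | mem x hx =>
    obtain ⟨i, hi, rfl⟩ := hx
    exact congrArg Subtype.val (hcoroot i hi)
  | zero => simp [cur_zero]
  | add x y _ _ hx hy =>
    rw [show ((x + y : H) : L) = x + y from rfl, cur_add, add_smul, hx, hy, map_add, add_smul]
  | smul z x _ hx =>
    rw [show ((z • x : H) : L) = z • (x : L) from rfl, cur_smul, smul_assoc, hx, map_smul,
      smul_assoc]

/-- The functor `V ↦ V_lam` preserves surjections out of an object of `I_A^lam`. -/
theorem exists_mem_weightSpace_map_eq (hV : weylProp A b lam V) {V' : ModuleCat.{u} (Env A L)}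
    (g : V →ₗ[Env A L] V') (hg : Function.Surjective g) {v' : V'}
    (hv' : v' ∈ GlobalWeyl.weightSpace V' lam) :
    ∃ v ∈ GlobalWeyl.weightSpace V lam, g v = v' := by
  obtain ⟨v, rfl⟩ := hg v'
  obtain ⟨F, hvF, hfd⟩ := exists_lieSubmodule_of_isLocallyFinite hV.1 v
  let p : F →ₗ⁅ℂ,H⁆ V' :=
    { (g.restrictScalars ℂ).comp F.toSubmodule.subtype with
      map_lie' := fun {h w} => map_smul g (cur 1 (h : L) : Env A L) (w : V) }
  have htop : (⟨v, hvF⟩ : F) ∈ genWeightSpace F (lam : H → ℂ) ⊔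
      ⨆ χ : H → ℂ, ⨆ _ : χ ≠ lam, genWeightSpace F χ := by
    rw [← iSup_split_single (fun χ : H → ℂ => genWeightSpace F χ) (lam : H → ℂ),
      LieModule.iSup_genWeightSpace_eq_top ℂ H F]
    trivial
  obtain ⟨x, hx, y, hy, hxy⟩ := (LieSubmodule.mem_sup _ _ _).mp htop
  refine ⟨x, mem_weightSpace_of_mem_genWeightSpace hV F hx, ?_⟩
  have hy' : p y ∈ ⨆ χ : H → ℂ, ⨆ _ : χ ≠ lam, genWeightSpace V' χ := by
    have h1 : p y ∈ LieSubmodule.map p (⨆ χ : H → ℂ, ⨆ _ : χ ≠ lam, genWeightSpace F χ) :=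
      LieSubmodule.mem_map_of_mem hy
    simp only [LieSubmodule.map_iSup] at h1
    exact (iSup₂_mono fun χ _ => map_genWeightSpace_le p) h1
  have hx' : p x ∈ genWeightSpace V' (lam : H → ℂ) :=
    map_genWeightSpace_le p (LieSubmodule.mem_map_of_mem hx)
  have hv2 : g v ∈ genWeightSpace V' (lam : H → ℂ) :=
    weightSpace_le_genWeightSpace V' _ ((LieModule.mem_weightSpace _ _).mpr hv')
  have hsum : p x + p y = g v := by rw [← map_add, hxy]; rfl
  have hy0 : p y ∈ genWeightSpace V' (lam : H → ℂ) := by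
    rw [← sub_eq_of_eq_add' hsum.symm]
    exact sub_mem hv2 hx'
  have := (LieModule.iSupIndep_genWeightSpace ℂ H V' (lam : H → ℂ)).le_bot ⟨hy0, hy'⟩
  rw [LieSubmodule.mem_bot] at this
  rw [← hsum, this, add_zero]
  rfl

theorem cur_pow_smul (x : L) (n : ℕ) (v : V) :
    (cur 1 x ^ n : Env A L) • v = (toEnd ℂ L V x ^ n) v := by
  induction n with
  | zero => simp
  | succ n ih => rw [pow_succ', pow_succ', mul_smul, ih]; rfl

/-- In an object of `I_A^lam`, every vector of weight `lam` satisfies the defining relations of the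
global Weyl module. -/
theorem smul_eq_zero_of_mem_weylIdeal (hV : weylProp A b lam V) {v : V}
    (hv : v ∈ GlobalWeyl.weightSpace V lam) {r : Env A L} (hr : r ∈ weylIdeal A b lam) :
    r • v = 0 := by
  refine (Submodule.span_le (p := LinearMap.ker (LinearMap.toSpanSingleton (Env A L) V v))).mpr
    (fun r hr => ?_) hr
  change r • v = 0
  cases hr with
  | raising α hα x hx a =>
    have := cur_smul_mem_weightSpace (chi := Φ α) hx a hv
    rwa [weightSpace_add_root_eq_bot hV hα, Submodule.mem_bot] at this
  | cartan h => rw [sub_smul, hv h, algebraMap_smul, sub_self]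
  | lowering i hi x hx n hn =>
    by_cases hv0 : v = 0
    · rw [hv0, smul_zero]
    have hi0 : (i : LieModule.Weight ℂ H L).IsNonZero := H.isNonZero_coe_root i
    obtain ⟨k, e, f, t, he, hf⟩ := LieAlgebra.IsKilling.exists_isSl2Triple_of_weight_isNonZero hi0
    have hk := t.h_eq_coroot hi0 he hf
    subst hk
    obtain ⟨c, hc⟩ : ∃ c : ℂ, c • f = x := by
      have h1 := LieAlgebra.IsKilling.finrank_rootSpace_eq_one
        (-(i : LieModule.Weight ℂ H L)) (by simpa using hi0)
      rw [LieModule.Weight.coe_neg] at h1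
      obtain ⟨c, hc⟩ := (finrank_eq_one_iff_of_nonzero' (⟨f, hf⟩ :
        LieAlgebra.rootSpace H (-(i : LieModule.Weight ℂ H L)))
        (by simpa using t.f_ne_zero)).mp h1 ⟨x, hx⟩
      exact ⟨c, congrArg Subtype.val hc⟩
    obtain ⟨F, hvF, hfd⟩ := exists_lieSubmodule_of_isLocallyFinite hV.1 v
    have he0 : ⁅e, v⁆ = 0 := by
      have := cur_smul_mem_weightSpace (chi := Φ i) he (1 : A) hv
      rwa [weightSpace_add_root_eq_bot hV (AddSubmonoid.subset_closure ⟨i, hi, rfl⟩),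
        Submodule.mem_bot] at this
    have P : t.HasPrimitiveVectorWith (⟨v, hvF⟩ : F)
        (lam (LieAlgebra.IsKilling.coroot (i : LieModule.Weight ℂ H L))) :=
      { ne_zero := fun h => hv0 (congrArg Subtype.val h)
        lie_h := Subtype.ext (hv _)
        lie_e := Subtype.ext he0 }
    have h1 := P.pow_toEnd_f_eq_zero_of_eq_nat hn
    have h2 : ∀ m : ℕ, (((toEnd ℂ L F f ^ m) ⟨v, hvF⟩ : F) : V) = (cur 1 f ^ m : Env A L) • v := by
      intro m
      induction m with
      | zero => simp
      | succ m ih => rw [pow_succ', pow_succ', mul_smul, ← ih]; rfl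
    rw [← hc, cur_smul, smul_pow, smul_assoc, ← h2, h1]
    simp

end TopWeight

/-! ### The global Weyl module and the Weyl functor -/

section Functor

open LieModule
open scoped ModuleCat

variable {L : Type u} [LieRing L] [LieAlgebra ℂ L] [FiniteDimensional ℂ L] [LieAlgebra.IsSimple ℂ L]
  {H : LieSubalgebra ℂ L} [H.IsCartanSubalgebra] {A : Type u} [CommRing A] [Algebra ℂ A]
  {b : (LieAlgebra.IsKilling.rootSystem H).Base} {lam : Module.Dual ℂ H}

attribute [local instance] curLieRingModule curLieModule

local notation "Φ" => RootPairing.root (LieAlgebra.IsKilling.rootSystem H)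

theorem smul_weylGen_of_rel {r : Env A L} (hr : WeylRel A b lam r) : r • weylGen A b lam = 0 := by
  have : r • weylGen A b lam = Submodule.Quotient.mk (p := weylIdeal A b lam) (r • 1) := rfl
  rw [this, smul_eq_mul, mul_one]
  exact (Submodule.Quotient.mk_eq_zero _).mpr (Submodule.subset_span hr)

variable (A b lam) in
/-- The global Weyl module as an object of the category of `𝔤 ⊗ A`-modules. -/
noncomputable def weylObj : ModuleCat.{u} (Env A L) := ModuleCat.of (Env A L) (WeylModule A b lam)

variable (A b lam) in
/-- The generator of the global Weyl module, as an element of `weylObj`. -/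
noncomputable def weylTop : weylObj A b lam := weylGen A b lam

theorem exists_smul_weylTop (x : weylObj A b lam) : ∃ u : Env A L, x = u • weylTop A b lam :=
  exists_smul_weylGen A b lam x

theorem raising_smul_weylTop (α : H.root) (hα : Φ α ∈ Qplus b) (x : L)
    (hx : x ∈ LieAlgebra.rootSpace H (Φ α : H → ℂ)) (a : A) :
    (cur a x : Env A L) • weylTop A b lam = 0 :=
  smul_weylGen_of_rel (.raising α hα x hx a)

theorem weylTop_mem_weightSpace :
    weylTop A b lam ∈ GlobalWeyl.weightSpace (weylObj A b lam) lam := fun h => by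
  have := smul_weylGen_of_rel (A := A) (b := b) (lam := lam) (.cartan h)
  rw [sub_smul, sub_eq_zero] at this
  rw [← algebraMap_smul (Env A L) (lam h) (weylTop A b lam)]
  exact this

/-- The global Weyl module is locally finite over `𝔤`. -/
theorem isLocallyFinite_weylObj (hlam : IsDominantIntegral b lam) :
    IsLocallyFinite (weylObj A b lam) := by
  refine isLocallyFinite_of_generator b raising_smul_weylTop weylTop_mem_weightSpace
    (fun i hi x hx => ?_) exists_smul_weylTop
  obtain ⟨n, hn⟩ := hlam i hi
  refine ⟨n + 1, ?_⟩
  rw [← cur_pow_smul]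
  exact smul_weylGen_of_rel (.lowering i hi x hx n hn)

/-- The action of an element of `𝐀_lam`, as an endomorphism of the `𝔤 ⊗ A`-module `W_A(lam)`. -/
noncomputable def weylAlgSMul (s : WeylAlg A b lam) : weylObj A b lam →ₗ[Env A L] weylObj A b lam :=
  rightActWeylAlg A b lam s

theorem weylAlgSMul_mk_weylTop (v : Env A H) :
    weylAlgSMul (Ideal.Quotient.mk (annIdeal A b lam) v) (weylTop A b lam) =
      cartanIncl H A v • weylTop A b lam := by
  have := rightAct_smul_weylGen A b lam v 1
  rw [one_smul, one_mul] at this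
  exact this

/-- `𝐀_lam` acts freely on the generator. -/
theorem eq_zero_of_weylAlgSMul_weylTop {s : WeylAlg A b lam}
    (hs : weylAlgSMul s (weylTop A b lam) = 0) : s = 0 := by
  obtain ⟨v, rfl⟩ := Ideal.Quotient.mk_surjective (I := annIdeal A b lam) s
  exact Ideal.Quotient.eq_zero_iff_mem.mpr ((weylAlgSMul_mk_weylTop v).symm.trans hs)

variable (A b lam) in
/-- The sum of the weight spaces of `W_A(lam)` of weights `< lam`. -/
noncomputable def lowerPart : Submodule ℂ (weylObj A b lam) :=
  ⨆ mu : Module.Dual ℂ H, ⨆ _ : lam - mu ∈ Qplus b ∧ mu ≠ lam,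
    GlobalWeyl.weightSpace (weylObj A b lam) mu

/-- `W_A(lam) = 𝐀_lam w + ⨁_{mu < lam} W_A(lam)_mu`. -/
theorem exists_weylAlgSMul_add_lowerPart (x : weylObj A b lam) :
    ∃ s : WeylAlg A b lam, ∃ y ∈ lowerPart A b lam, x = weylAlgSMul s (weylTop A b lam) + y := by
  obtain ⟨p, ⟨v, rfl⟩, y, hy, rfl⟩ := Submodule.mem_sup.mp
    (mem_cartanSpan_sup_iSup_weightSpace b raising_smul_weylTop weylTop_mem_weightSpace
      exists_smul_weylTop x)
  exact ⟨_, y, hy, by rw [← weylAlgSMul_mk_weylTop]; rfl⟩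

theorem weylAlgSMul_weylTop_mem_weightSpace (s : WeylAlg A b lam) :
    weylAlgSMul s (weylTop A b lam) ∈ GlobalWeyl.weightSpace (weylObj A b lam) lam :=
  map_mem_weightSpace (weylAlgSMul s) weylTop_mem_weightSpace

variable (A b lam) in
/-- The sum of the weight spaces of weights `< lam`, as an `𝐀_lam`-submodule. -/
noncomputable def lowerSubmodule : Submodule (WeylAlg A b lam) (WeylModule A b lam) where
  carrier := (lowerPart A b lam : Set (weylObj A b lam))
  zero_mem' := (lowerPart A b lam).zero_mem
  add_mem' := (lowerPart A b lam).add_mem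
  smul_mem' s _ hx := map_mem_iSup_weightSpace (weylAlgSMul s) hx

variable (A b lam) in
/-- The generator splits off: there is an `𝐀_lam`-linear projection `W_A(lam) → 𝐀_lam` which maps
`w` to `1`, given by the `lam`-component. -/
theorem exists_weylProj : ∃ π : WeylModule A b lam →ₗ[WeylAlg A b lam] WeylAlg A b lam,
    π (weylGen A b lam) = 1 := by
  -- `g : 𝐀_lam → W_A(lam)` is injective, and its image is complementary to the lower weight spaces
  let g := LinearMap.toSpanSingleton (WeylAlg A b lam) (WeylModule A b lam) (weylGen A b lam)
  have hg : Function.Injective g := by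
    rw [← LinearMap.ker_eq_bot, LinearMap.ker_eq_bot']
    exact fun s hs => eq_zero_of_weylAlgSMul_weylTop hs
  have hcompl : IsCompl (LinearMap.range g) (lowerSubmodule A b lam) := by
    constructor
    · rw [Submodule.disjoint_def]
      rintro _ ⟨s, rfl⟩ hs
      have hs' : weylAlgSMul s (weylTop A b lam) ∈ lowerPart A b lam := hs
      exact eq_zero_of_mem_weightSpace_of_mem_iSup
        (T := fun mu => lam - mu ∈ Qplus b ∧ mu ≠ lam) (fun h => h.2 rfl)
        (weylAlgSMul_weylTop_mem_weightSpace s) hs'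
    · rw [codisjoint_iff, Submodule.eq_top_iff']
      intro x
      obtain ⟨s, y, hy, rfl⟩ :=
        exists_weylAlgSMul_add_lowerPart (A := A) (b := b) (lam := lam) x
      exact Submodule.add_mem_sup (S := LinearMap.range g) (T := lowerSubmodule A b lam)
        ⟨s, rfl⟩ hy
  refine ⟨(LinearEquiv.ofInjective g hg).symm.toLinearMap ∘ₗ
    Submodule.projectionOnto _ _ hcompl, ?_⟩
  have h1 : weylGen A b lam = ((LinearEquiv.ofInjective g hg 1 : LinearMap.range g) :
      WeylModule A b lam) := (one_smul _ _).symm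
  rw [LinearMap.comp_apply, h1, Submodule.projectionOnto_apply_left]
  exact LinearEquiv.symm_apply_apply _ _

/-- The map `x ↦ x ⊗ m`, from `W_A(lam)` to the value of the Weyl functor at `M`. -/
noncomputable def weylTmul {M : ModuleCat.{u} (WeylAlg A b lam)} (m : M) :
    weylObj A b lam →ₗ[Env A L] (weylFunctor A b lam).obj M where
  toFun := fun x : WeylModule A b lam => x ⊗ₜ[WeylAlg A b lam] m
  map_add' := fun x y : WeylModule A b lam => TensorProduct.add_tmul x y m
  map_smul' := fun u (x : WeylModule A b lam) => (TensorProduct.smul_tmul' u x m).symm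

variable {M N : ModuleCat.{u} (WeylAlg A b lam)}

/-- Induction on the vectors of `W_A(lam) ⊗ M`, in terms of the maps `weylTmul m`. -/
theorem weylFunctor_induction {p : (weylFunctor A b lam).obj M → Prop}
    (tmul : ∀ m x, p (weylTmul m x)) (add : ∀ x y, p x → p y → p (x + y))
    (x : (weylFunctor A b lam).obj M) : p x :=
  TensorProduct.induction_on (motive := p) x
    (by have := tmul 0 0; rwa [map_zero] at this) (fun x m => tmul m x) (fun x y => add x y)

theorem weylTmul_add (m m' : M) (x : weylObj A b lam) :
    weylTmul (m + m') x = weylTmul m x + weylTmul m' x :=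
  TensorProduct.tmul_add (M := WeylModule A b lam) x m m'

theorem weylTmul_zero (x : weylObj A b lam) : weylTmul (0 : M) x = 0 :=
  TensorProduct.tmul_zero (M := WeylModule A b lam) M x

theorem weylTmul_weylAlgSMul (m : M) (s : WeylAlg A b lam) (x : weylObj A b lam) :
    weylTmul m (weylAlgSMul s x) = weylTmul (s • m) x :=
  TensorProduct.smul_tmul (M := WeylModule A b lam) s x m

/-- `W_A(lam) ⊗ M` contains `M` as `w ⊗ M`, because the generator splits off. -/
theorem eq_zero_of_weylTmul_weylTop {m : M} (hm : weylTmul m (weylTop A b lam) = 0) : m = 0 := by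
  obtain ⟨π, hπ⟩ := exists_weylProj A b lam
  have h1 : weylGen A b lam ⊗ₜ[WeylAlg A b lam] m = 0 := hm
  have h2 := congrArg (fun x => TensorProduct.lid _ _ (LinearMap.rTensor M π x)) h1
  simpa [hπ] using h2

variable (M) in
/-- `W_A(lam) ⊗ M` is the sum of `w ⊗ M` and of weight spaces of weights `< lam`. -/
theorem exists_weylTmul_add (x : (weylFunctor A b lam).obj M) :
    ∃ (m : M) (y : (weylFunctor A b lam).obj M),
      y ∈ ⨆ mu : Module.Dual ℂ H, ⨆ _ : lam - mu ∈ Qplus b ∧ mu ≠ lam,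
        GlobalWeyl.weightSpace ((weylFunctor A b lam).obj M) mu ∧
      x = weylTmul m (weylTop A b lam) + y := by
  induction x using weylFunctor_induction with
  | tmul m x =>
    obtain ⟨s, y, hy, rfl⟩ := exists_weylAlgSMul_add_lowerPart x
    refine ⟨s • m, weylTmul m y, ?_, by rw [map_add, weylTmul_weylAlgSMul]⟩
    exact map_mem_iSup_weightSpace (T := fun mu => lam - mu ∈ Qplus b ∧ mu ≠ lam) (weylTmul m) hy
  | add x x' hx hx' =>
    obtain ⟨m, y, hy, rfl⟩ := hx
    obtain ⟨m', y', hy', rfl⟩ := hx'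
    exact ⟨m + m', y + y', Submodule.add_mem _ hy hy', by rw [weylTmul_add]; abel⟩

theorem weylTmul_weylTop_mem_weightSpace (m : M) :
    weylTmul m (weylTop A b lam) ∈ GlobalWeyl.weightSpace ((weylFunctor A b lam).obj M) lam :=
  map_mem_weightSpace (weylTmul m) weylTop_mem_weightSpace

/-- The weight space of weight `lam` of `W_A(lam) ⊗ M` is `w ⊗ M`. -/
theorem exists_eq_weylTmul_of_mem_weightSpace {x : (weylFunctor A b lam).obj M}
    (hx : x ∈ GlobalWeyl.weightSpace ((weylFunctor A b lam).obj M) lam) :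
    ∃ m : M, x = weylTmul m (weylTop A b lam) := by
  obtain ⟨m, y, hy, rfl⟩ := exists_weylTmul_add M x
  refine ⟨m, ?_⟩
  have h1 : y ∈ GlobalWeyl.weightSpace ((weylFunctor A b lam).obj M) lam := by
    have := Submodule.sub_mem _ hx (weylTmul_weylTop_mem_weightSpace m)
    rwa [add_sub_cancel_left] at this
  rw [eq_zero_of_mem_weightSpace_of_mem_iSup (T := fun mu => lam - mu ∈ Qplus b ∧ mu ≠ lam)
    (fun h => h.2 rfl) h1 hy, add_zero]

variable (M) in
/-- The Weyl functor takes values in `I_A^lam`. -/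
theorem weylProp_weylFunctor_obj (hlam : IsDominantIntegral b lam) :
    weylProp A b lam ((weylFunctor A b lam).obj M) := by
  refine ⟨?_, fun mu => sub_mem_Qplus_of_weightSpace_ne_bot b fun x => ?_⟩
  · rw [isLocallyFinite_iff_locFinPart_eq_top, Submodule.eq_top_iff']
    have h := isLocallyFinite_iff_locFinPart_eq_top.mp (isLocallyFinite_weylObj (A := A) hlam)
    intro x
    induction x using weylFunctor_induction with
    | tmul m x => exact map_mem_locFinPart (weylTmul m) (h ▸ trivial)
    | add x y hx hy => exact Submodule.add_mem _ hx hy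
  · obtain ⟨m, y, hy, rfl⟩ := exists_weylTmul_add M x
    refine Submodule.add_mem _ (Submodule.mem_iSup_of_mem lam (Submodule.mem_iSup_of_mem
      (by simp) (weylTmul_weylTop_mem_weightSpace m))) ?_
    exact (iSup_mono fun nu => iSup_mono' fun hnu => ⟨hnu.1, le_rfl⟩ :
      (⨆ mu : Module.Dual ℂ H, ⨆ _ : lam - mu ∈ Qplus b ∧ mu ≠ lam,
        GlobalWeyl.weightSpace ((weylFunctor A b lam).obj M) mu) ≤ _) hy

/-- Morphisms out of `W_A(lam) ⊗ M` are determined by the images of the vectors `w ⊗ m`. -/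
theorem weylFunctor_obj_ext {V : ModuleCat.{u} (Env A L)}
    {f g : (weylFunctor A b lam).obj M →ₗ[Env A L] V}
    (h : ∀ m : M, f (weylTmul m (weylTop A b lam)) = g (weylTmul m (weylTop A b lam))) :
    f = g := by
  refine LinearMap.ext fun x => ?_
  induction x using weylFunctor_induction with
  | tmul m x =>
    obtain ⟨u, rfl⟩ := exists_smul_weylTop x
    rw [map_smul, map_smul, map_smul, h]
  | add x y hx hy => rw [map_add, map_add, hx, hy]

/-- The universal property of the global Weyl module in `I_A^lam`. -/
theorem exists_hom_weylObj {V : ModuleCat.{u} (Env A L)} (hV : weylProp A b lam V) {v : V}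
    (hv : v ∈ GlobalWeyl.weightSpace V lam) :
    ∃ ψ : weylObj A b lam →ₗ[Env A L] V, ψ (weylTop A b lam) = v := by
  refine ⟨Submodule.liftQ (weylIdeal A b lam) (LinearMap.toSpanSingleton (Env A L) V v)
    (fun r hr => smul_eq_zero_of_mem_weylIdeal hV hv hr), ?_⟩
  exact one_smul (Env A L) v

variable (A b lam) in
/-- The free `𝐀_lam`-module on `X`. -/
noncomputable abbrev freeObj (X : Type u) : ModuleCat.{u} (WeylAlg A b lam) :=
  ModuleCat.of (WeylAlg A b lam) (X →₀ WeylAlg A b lam)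

variable (A b lam) in
/-- The vector `w ⊗ x` of `W_A(lam) ⊗ F`, for a basis vector `x` of the free module `F`. -/
noncomputable def freeTop {X : Type u} (x : X) : (weylFunctor A b lam).obj (freeObj A b lam X) :=
  weylTmul (M := freeObj A b lam X) (Finsupp.single x 1) (weylTop A b lam)

/-- A family of vectors of weight `lam` extends to a morphism from `W_A(lam) ⊗ F`, where `F` is the
free `𝐀_lam`-module on the index set. -/
theorem exists_hom_weylFunctor_free {V : ModuleCat.{u} (Env A L)} (hV : weylProp A b lam V)
    {X : Type u} (v : X → V) (hv : ∀ x, v x ∈ GlobalWeyl.weightSpace V lam) :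
    ∃ Ψ : (weylFunctor A b lam).obj (freeObj A b lam X) →ₗ[Env A L] V,
      ∀ x, Ψ (freeTop A b lam x) = v x := by
  classical
  choose ψ hψ using fun x => exists_hom_weylObj hV (hv x)
  -- the tensor product with a free module is a direct sum of copies of `W_A(lam)`
  let S : (X →₀ WeylModule A b lam) →+ V := Finsupp.liftAddHom fun x => (ψ x).toAddMonoidHom
  let Ψ₀ : (weylFunctor A b lam).obj (freeObj A b lam X) →+ V :=
    S.comp (TensorProduct.finsuppScalarRight (WeylAlg A b lam) (WeylAlg A b lam)
      (WeylModule A b lam) X).toAddEquiv.toAddMonoidHom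
  have hΨ : ∀ (y : weylObj A b lam) (x : X) (s : WeylAlg A b lam),
      Ψ₀ (weylTmul (M := freeObj A b lam X) (Finsupp.single x s) y) = ψ x (weylAlgSMul s y) := by
    intro (y : WeylModule A b lam) x s
    have h1 : TensorProduct.finsuppScalarRight (WeylAlg A b lam) (WeylAlg A b lam)
        (WeylModule A b lam) X (y ⊗ₜ Finsupp.single x s) =
          Finsupp.single x (s • y) := by
      rw [TensorProduct.finsuppScalarRight_apply_tmul, Finsupp.sum_single_index (by simp)]
    exact (congrArg S h1).trans (Finsupp.liftAddHom_apply_single _ _ _)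
  have hlin : ∀ (u : Env A L) (f : X →₀ WeylAlg A b lam) (y : weylObj A b lam),
      Ψ₀ (weylTmul (M := freeObj A b lam X) f (u • y)) =
        u • Ψ₀ (weylTmul (M := freeObj A b lam X) f y) := by
    intro u f y
    induction f using Finsupp.induction_linear with
    | zero =>
      have h0 : ∀ z, Ψ₀ (weylTmul (M := freeObj A b lam X) (0 : X →₀ WeylAlg A b lam) z) = 0 :=
        fun z => (congrArg Ψ₀ (weylTmul_zero z)).trans (map_zero Ψ₀)
      rw [h0, h0, smul_zero]
    | add f g hf hg =>
      have h0 : ∀ z, Ψ₀ (weylTmul (M := freeObj A b lam X) (f + g) z) =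
          Ψ₀ (weylTmul (M := freeObj A b lam X) f z) + Ψ₀ (weylTmul (M := freeObj A b lam X) g z) :=
        fun z => (congrArg Ψ₀ (weylTmul_add (M := freeObj A b lam X) f g z)).trans (map_add Ψ₀ _ _)
      rw [h0, h0, hf, hg, smul_add]
    | single x s => rw [hΨ, hΨ, map_smul, map_smul]
  refine ⟨{ Ψ₀ with map_smul' := fun u z => ?_ }, fun x => ?_⟩
  · change Ψ₀ (u • z) = u • Ψ₀ z
    induction z using weylFunctor_induction with
    | tmul m x => rw [← map_smul, hlin]
    | add z₁ z₂ h₁ h₂ => rw [smul_add, map_add, map_add, smul_add, h₁, h₂]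
  · refine (hΨ _ x 1).trans ((congrArg (ψ x) ?_).trans (hψ x))
    exact one_smul (WeylAlg A b lam) (weylGen A b lam)

end Functor

/-! ### Projectivity and right exactness of the Weyl functor -/

section Exactness

open scoped ModuleCat

variable {L : Type u} [LieRing L] [LieAlgebra ℂ L] [FiniteDimensional ℂ L] [LieAlgebra.IsSimple ℂ L]
  {H : LieSubalgebra ℂ L} [H.IsCartanSubalgebra] {A : Type u} [CommRing A] [Algebra ℂ A]
  {b : (LieAlgebra.IsKilling.rootSystem H).Base} {lam : Module.Dual ℂ H}

/-- Kernels and cokernels in `I_A^lam` are those of `𝔤 ⊗ A`-modules. -/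
instance : (weylProp A b lam).ι.PreservesHomology where
  preservesKernels _ _ f := by
    have := (weylProp A b lam).preservesKernels_ι
    infer_instance
  preservesCokernels _ _ f := by
    have := (weylProp A b lam).preservesCokernels_ι
    infer_instance

theorem weylCat_epi_iff {V W : WeylCat A b lam} (f : V ⟶ W) :
    Epi f ↔ Function.Surjective f.hom.hom := by
  rw [← ModuleCat.epi_iff_surjective]
  exact ((weylProp A b lam).ι.epi_map_iff_epi f).symm

theorem weylCat_mono_iff {V W : WeylCat A b lam} (f : V ⟶ W) :
    Mono f ↔ Function.Injective f.hom.hom := by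
  rw [← ModuleCat.mono_iff_injective]
  exact ((weylProp A b lam).ι.mono_map_iff_mono f).symm

theorem weylCat_exact_iff (S : ShortComplex (WeylCat A b lam)) :
    S.Exact ↔ Function.Exact S.f.hom.hom S.g.hom.hom := by
  rw [← S.exact_map_iff_of_faithful (weylProp A b lam).ι]
  exact ShortComplex.ShortExact.moduleCat_exact_iff_function_exact _

/-- Every `𝐀_lam`-module is a quotient of a free one. -/
theorem exists_freeObj_epi (M : ModuleCat.{u} (WeylAlg A b lam)) :
    ∃ p : freeObj A b lam M ⟶ M, Epi p := by
  refine ⟨ModuleCat.ofHom (Finsupp.linearCombination (WeylAlg A b lam) (fun m : M => m)), ?_⟩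
  rw [ModuleCat.epi_iff_surjective]
  exact Finsupp.linearCombination_id_surjective (WeylAlg A b lam) M

/-- Morphisms out of `W_A(lam) ⊗ F`, for a free module `F`, are determined by the images of the
vectors `w ⊗ x` with `x` a basis vector. -/
theorem weylFunctor_free_ext {X : Type u} {V : ModuleCat.{u} (Env A L)}
    {f g : (weylFunctor A b lam).obj (freeObj A b lam X) →ₗ[Env A L] V}
    (h : ∀ x : X, f (freeTop A b lam x) = g (freeTop A b lam x)) : f = g := by
  have key : ∀ x (s : WeylAlg A b lam) (y : weylObj A b lam),
      f (weylTmul (M := freeObj A b lam X) (Finsupp.single x s) y) =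
        g (weylTmul (M := freeObj A b lam X) (Finsupp.single x s) y) := by
    intro x s y
    have hs : (Finsupp.single x s : freeObj A b lam X) =
        s • (Finsupp.single x 1 : X →₀ WeylAlg A b lam) := by simp
    rw [hs]
    obtain ⟨u, hu⟩ := exists_smul_weylTop (weylAlgSMul s y)
    have e : weylTmul (M := freeObj A b lam X) (s • (Finsupp.single x 1 : X →₀ WeylAlg A b lam)) y =
        u • freeTop A b lam x := by
      refine (weylTmul_weylAlgSMul (M := freeObj A b lam X) (Finsupp.single x 1) s y).symm.trans ?_
      rw [hu, map_smul]
      rfl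
    refine (congrArg f e).trans (Eq.trans ?_ (congrArg g e).symm)
    rw [map_smul, map_smul, h]
  refine weylFunctor_obj_ext fun (m : X →₀ WeylAlg A b lam) => ?_
  induction m using Finsupp.induction_linear with
  | zero =>
    have e := weylTmul_zero (M := freeObj A b lam X) (weylTop A b lam)
    exact (congrArg f e).trans ((map_zero f).trans ((congrArg g e).trans (map_zero g)).symm)
  | add m m' hm hm' =>
    have e := weylTmul_add (M := freeObj A b lam X) m m' (weylTop A b lam)
    refine (congrArg f e).trans (Eq.trans ?_ (congrArg g e).symm)
    rw [map_add, map_add, hm, hm']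
  | single x s => exact key x s _

variable (hW : ∀ M : ModuleCat.{u} (WeylAlg A b lam),
  weylProp A b lam ((weylFunctor A b lam).obj M))

/-- The Weyl functor maps free modules to projective objects of `I_A^lam`: morphisms from
`W_A(lam) ⊗ F` are families of vectors of weight `lam`, and these lift along epimorphisms. -/
theorem projective_weylFunctor_free (X : Type u) :
    Projective (((weylProp A b lam).lift (weylFunctor A b lam) hW).obj (freeObj A b lam X)) where
  factors {V W} f e he := by
    choose v hv hve using fun x : X => exists_mem_weightSpace_map_eq V.property
      e.hom.hom ((weylCat_epi_iff e).mp he)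
      (map_mem_weightSpace f.hom.hom (weylTmul_weylTop_mem_weightSpace
        (M := freeObj A b lam X) (Finsupp.single x 1)))
    obtain ⟨Ψ, hΨ⟩ := exists_hom_weylFunctor_free V.property v hv
    refine ⟨ObjectProperty.homMk (ModuleCat.ofHom Ψ), ?_⟩
    ext1
    refine ModuleCat.hom_ext (weylFunctor_free_ext fun x => ?_)
    exact (congrArg e.hom.hom (hΨ x)).trans (hve x)

/-- The Weyl functor is right exact. -/
theorem weylFunctor_right_exact {S : ShortComplex (ModuleCat.{u} (WeylAlg A b lam))}
    (hS : S.ShortExact) :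
    (S.map ((weylProp A b lam).lift (weylFunctor A b lam) hW)).Exact ∧
      Epi (((weylProp A b lam).lift (weylFunctor A b lam) hW).map S.g) := by
  have hg : Function.Surjective S.g.hom := hS.moduleCat_surjective_g
  have hex := (ShortComplex.ShortExact.moduleCat_exact_iff_function_exact S).mp hS.exact
  exact ⟨(weylCat_exact_iff _).mpr (lTensor_exact (WeylModule A b lam) hex hg),
    (weylCat_epi_iff _).mpr (LinearMap.lTensor_surjective (WeylModule A b lam) hg)⟩

/-- Not an instance: it would compete with the general instance that lifts to a full subcategory
preserve zero morphisms, which `ShortComplex.map` uses. -/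
theorem additive_weylFunctor : ((weylProp A b lam).lift (weylFunctor A b lam) hW).Additive where
  map_add {M N f g} := by
    ext1
    exact (weylFunctor A b lam).map_add

end Exactness

end GlobalWeyl

theorem mainTheorem2 {L : Type u} [LieRing L] [LieAlgebra ℂ L] [FiniteDimensional ℂ L]
    [LieAlgebra.IsSimple ℂ L] {H : LieSubalgebra ℂ L} [H.IsCartanSubalgebra]
    (b : (LieAlgebra.IsKilling.rootSystem H).Base)
    (A : Type u) [CommRing A] [Algebra ℂ A]
    (lam : Module.Dual ℂ H) (hlam : IsDominantIntegral b lam) :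
    ∃ hW : ∀ M : ModuleCat.{u} (WeylAlg A b lam), weylProp A b lam ((weylFunctor A b lam).obj M),
      (∀ S : ShortComplex (ModuleCat.{u} (WeylAlg A b lam)), S.ShortExact →
          (S.map ((weylProp A b lam).lift (weylFunctor A b lam) hW)).ShortExact) ↔
        ∀ (M : ModuleCat.{u} (WeylAlg A b lam)) (U : WeylCat A b lam),
          weightSpace U.obj lam = ⊥ →
            Subsingleton
              (Abelian.Ext (((weylProp A b lam).lift (weylFunctor A b lam) hW).obj M) U 2) := by
  refine ⟨fun M => weylProp_weylFunctor_obj M hlam, ?_⟩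
  have := additive_weylFunctor (A := A) (b := b) (lam := lam)
    fun M => weylProp_weylFunctor_obj M hlam
  refine exact_iff_subsingleton_ext_two _ (fun M => ?_) (fun S hS => weylFunctor_right_exact _ hS)
    (fun U : WeylCat A b lam => weightSpace U.obj lam = ⊥) (fun M U hU f => ?_)
    (fun {M N} f hf K k hk hkf => ?_)
  -- free modules give projective objects
  · obtain ⟨p, hp⟩ := exists_freeObj_epi M
    exact ⟨_, p, hp, projective_weylFunctor_free _ M⟩
  -- a morphism to `U` maps the generators `w ⊗ m` into `U_lam = 0`
  · ext1
    refine ModuleCat.hom_ext (weylFunctor_obj_ext fun m => ?_)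
    have h := map_mem_weightSpace f.hom.hom (weylTmul_weylTop_mem_weightSpace m)
    rwa [hU, Submodule.mem_bot] at h
  -- a vector of weight `lam` of `W_A(lam) ⊗ M` is of the form `w ⊗ m`, and `w ⊗ f m` only vanishes
  -- if `f m` does
  · refine bot_unique fun v hv => ?_
    obtain ⟨m, hm⟩ := exists_eq_weylTmul_of_mem_weightSpace (M := M)
      (map_mem_weightSpace k.hom.hom hv)
    have h1 : weylTmul (f.hom m) (weylTop A b lam) = 0 :=
      (congrArg ((weylFunctor A b lam).map f).hom hm).symm.trans
        (congrArg (fun φ : K ⟶ _ => φ.hom.hom v) hkf)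
    have h2 : m = 0 := (ModuleCat.mono_iff_injective f).mp hf
      ((eq_zero_of_weylTmul_weylTop h1).trans (map_zero f.hom).symm)
    refine (weylCat_mono_iff k).mp hk (hm.trans ?_)
    rw [h2, weylTmul_zero]
    exact (map_zero k.hom.hom).symm
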